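/- Let $p$ be a prime, $n\ge 1$, let $\alpha\in\overline{\mathbb F_p}$ be a non-zero element of multiplicative order greater than $n$ and not in $\{1,2,3,4,5,6,8,10\}$, let $\beta\in\overline{\mathbb F_p}\setminus\{0,1\}$ with $\beta\ne-\alpha^i$ for all integers $i$ with $-(n-1)\le i\le n-1$, and put $\mathbb F_q=\mathbb F_p(\alpha,\beta)$. Let $A_{B_n}$ be the Artin group of type $B_n$, with generators $T=S_0,S_1,\dots,S_{n-1}$ and relations $S_0S_1S_0S_1=S_1S_0S_1S_0$, $S_iS_{i+1}S_i=S_{i+1}S_iS_{i+1}$ for $1\le i\le n-2$, and $S_iS_j=S_jS_i$ for $|i-j|\ge 2$; let $\mathcal A=[A_{B_n},A_{B_n}]$ be its derived subgroup. A double-partition of $n$ is a pair $\lambda=(\lambda_1,\lambda_2)$ of partitions of total size $n$. For a partition $\nu$ let $\nu'$ be its transpose, and put $\lambda'=(\lambda_2',\lambda_1')$. Let $R_\lambda$ be the representation of $A_{B_n}$ over $\mathbb F_q$ with basis the standard double-tableaux $\mathbb T=(\mathbb T_1,\mathbb T_2)$ of shape $\lambda$ (the numbers $1,\dots,n$ are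 placed in the boxes of the two diagrams, each once, increasing along rows and columns of each diagram), given by the Hoefsmit model: $T\cdot\mathbb T=\beta\,\mathbb T$ if $1\in\mathbb T_1$ and $T\cdot\mathbb T=-\mathbb T$ if $1\in\mathbb T_2$; and, for $1\le i\le n-1$, $$S_i\cdot\mathbb T=m_i(\mathbb T)\,\mathbb T+(1+m_i(\mathbb T))\,\widetilde{\mathbb T},\qquad m_i(\mathbb T)=\frac{\alpha-1}{1-\frac{ct(\mathbb T:i)}{ct(\mathbb T:i+1)}},$$ where $\widetilde{\mathbb T}$ is $\mathbb T$ with $i$ and $i+1$ interchanged if this is standard, and $0$ otherwise, and where, if $j$ lies in row $r$ and column $c$ of its diagram, $ct(\mathbb T:j)=\beta\alpha^{c-r}$ if $j\in\mathbb T_1$ and $ct(\mathbb T:j)=-\alpha^{c-r}$ if $j\in\mathbb T_2$. Write $R^\star$ for the dual of a representation $R$, and, for a field automorphism $\epsilon$ of $\mathbb F_q$, write $\epsilon\circ R$ for the representation obtained by applying $\epsilon$ to the matrix entries in the given basis. Let $\lambda$ and $\mu$ be double-partitions of $n$, both with two non-empty components. All isomorphisms below are between representations of $\mathcal A$ over $\mathbb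 F_q$, the representations of $A_{B_n}$ being restricted to $\mathcal A$. 1. If $\mathbb F_q=\mathbb F_p(\alpha+\alpha^{-1},\beta+\beta^{-1})$, then (a) $R_\lambda\simeq R_\mu\Leftrightarrow\lambda=\mu$; (b) $R_\lambda\simeq R_\mu^\star\Leftrightarrow\lambda=\mu'$. In each of the cases 2, 3 and 4 below, $\mathbb F_q$ has exactly one field automorphism of order $2$; call it $\epsilon$. 2. If $\mathbb F_q=\mathbb F_p(\alpha+\alpha^{-1},\beta)=\mathbb F_p(\alpha,\beta+\beta^{-1})\ne\mathbb F_p(\alpha+\alpha^{-1},\beta+\beta^{-1})$, then (a) $R_\lambda\simeq R_\mu\Leftrightarrow\lambda=\mu$; (b) $R_\lambda\simeq R_\mu^\star\Leftrightarrow\lambda=\mu'$; (c) $R_\lambda\simeq\epsilon\circ R_\mu\Leftrightarrow\lambda=\mu'$; (d) $R_\lambda\simeq\epsilon\circ R_\mu^\star\Leftrightarrow\lambda=\mu$. 3. If $\mathbb F_q=\mathbb F_p(\alpha,\beta+\beta^{-1})\ne\mathbb F_p(\alpha+\alpha^{-1},\beta)=\mathbb F_p(\alpha+\alpha^{-1},\beta+\beta^{-1})$,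 then (a) $R_\lambda\simeq R_\mu\Leftrightarrow\lambda=\mu$; (b) $R_\lambda\simeq R_\mu^\star\Leftrightarrow\lambda=\mu'$; (c) $R_\lambda\simeq\epsilon\circ R_\mu\Leftrightarrow\lambda=(\mu_1',\mu_2')$; (d) $R_\lambda\simeq\epsilon\circ R_\mu^\star\Leftrightarrow\lambda=(\mu_2,\mu_1)$. 4. If $\mathbb F_q=\mathbb F_p(\alpha+\alpha^{-1},\beta)\ne\mathbb F_p(\alpha,\beta+\beta^{-1})=\mathbb F_p(\alpha+\alpha^{-1},\beta+\beta^{-1})$, then (a) $R_\lambda\simeq R_\mu\Leftrightarrow\lambda=\mu$; (b) $R_\lambda\simeq R_\mu^\star\Leftrightarrow\lambda=\mu'$; (c) $R_\lambda\simeq\epsilon\circ R_\mu\Leftrightarrow\lambda=(\mu_2,\mu_1)$; (d) $R_\lambda\simeq\epsilon\circ R_\mu^\star\Leftrightarrow\lambda=(\mu_1',\mu_2')$. -/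

import Mathlib

open scoped Matrix MatrixGroups

/-- A double-partition `(l₁, l₂)` of `n`, given by its two Young diagrams. -/
@[ext]
structure DoublePartition (n : ℕ) where
  fst : YoungDiagram
  snd : YoungDiagram
  card_add : fst.card + snd.card = n

namespace DoublePartition

variable {n : ℕ}

theorem card_transpose (μ : YoungDiagram) : μ.transpose.card = μ.card := by
  simp [YoungDiagram.card, YoungDiagram.transpose]

/-- `(l₁, l₂) ↦ (l₂', l₁')`. -/
def transpose (l : DoublePartition n) : DoublePartition n where
  fst := l.snd.transpose
  snd := l.fst.transpose
  card_add := by rw [card_transpose, card_transpose, add_comm, l.card_add]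

/-- `(l₁, l₂) ↦ (l₁', l₂')`. -/
def transposeEach (l : DoublePartition n) : DoublePartition n where
  fst := l.fst.transpose
  snd := l.snd.transpose
  card_add := by rw [card_transpose, card_transpose, l.card_add]

/-- `(l₁, l₂) ↦ (l₂, l₁)`. -/
def swap (l : DoublePartition n) : DoublePartition n where
  fst := l.snd
  snd := l.fst
  card_add := by rw [add_comm, l.card_add]

/-- Neither component is the empty partition. -/
def NoEmptyComponent (l : DoublePartition n) : Prop :=
  l.fst ≠ ⊥ ∧ l.snd ≠ ⊥

/-- The two components, indexed by `0` (left) and `1` (right). -/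
def comp (l : DoublePartition n) : Fin 2 → YoungDiagram :=
  ![l.fst, l.snd]

/-- The boxes of the two diagrams. With Mathlib's order on a sigma type, two boxes are comparable
iff they are in the same component, and then they are compared by row and by column. -/
abbrev Box (l : DoublePartition n) : Type :=
  Σ k : Fin 2, (l.comp k).cells

namespace Box

variable {l : DoublePartition n}

/-- Row of a box, counted from `0`. -/
def row (b : l.Box) : ℕ := b.2.1.1

/-- Column of a box, counted from `0`. -/
def col (b : l.Box) : ℕ := b.2.1.2

end Box

/-- A filling of the boxes with `0, …, n - 1`, each used once; the number written `i + 1` in the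
usual convention is `i` here. -/
abbrev Filling (l : DoublePartition n) : Type :=
  l.Box ≃ Fin n

/-- Standard double-tableaux: entries increase to the right and to the bottom
within each component. -/
def StdTableau (l : DoublePartition n) : Type :=
  {f : l.Filling // StrictMono f}

instance (l : DoublePartition n) : Finite l.StdTableau :=
  inferInstanceAs (Finite {f : l.Filling // StrictMono f})

noncomputable instance (l : DoublePartition n) : Fintype l.StdTableau :=
  Fintype.ofFinite _

noncomputable instance (l : DoublePartition n) : DecidableEq l.StdTableau :=
  Classical.decEq _

/-- Interchange the entries `i` and `j` of a filling. -/
def Filling.exchange {l : DoublePartition n} (f : l.Filling) (i j : Fin n) : l.Filling :=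
  f.trans (Equiv.swap i j)

end DoublePartition

section Hoefsmit

open DoublePartition

variable {n : ℕ} {K : Type*} [Field K]

/-- The content: `β α ^ (c - r)` in the left component, `- α ^ (c - r)` in the right one. -/
def boxContent (α β : K) {l : DoublePartition n} (b : l.Box) : K :=
  if b.1 = 0 then β * α ^ ((b.col : ℤ) - (b.row : ℤ)) else -α ^ ((b.col : ℤ) - (b.row : ℤ))

/-- `(α - 1) / (1 - ct(i) / ct(j))`, where `ct(i)` is the content of the box with entry `i`. -/
def hoefsmitCoeff (α β : K) {l : DoublePartition n} (f : l.Filling) (i j : Fin n) : K :=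
  (α - 1) / (1 - boxContent α β (f.symm i) / boxContent α β (f.symm j))

open scoped Classical in
/-- The basis vector of a filling if it is a standard tableau, and `0` otherwise. -/
noncomputable def fillingVec (K : Type*) [Field K] {l : DoublePartition n} (f : l.Filling) :
    l.StdTableau → K :=
  fun T => if T.1 = f then 1 else 0

/-- Matrix of `T`: it multiplies a tableau by `β` if its entry `i` (to be taken as the first one)
lies in the left component, and by `-1` otherwise. -/
noncomputable def hoefsmitT (β : K) (l : DoublePartition n) (i : Fin n) :
    Matrix l.StdTableau l.StdTableau K :=
  Matrix.diagonal fun T => if (T.1.symm i).1 = 0 then β else -1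

/-- Matrix of the generator that mixes the consecutive entries `i` and `j`; its column at
the tableau `T` is `m(T) T + (1 + m(T)) T_{i ↔ j}`. -/
noncomputable def hoefsmitS (α β : K) (l : DoublePartition n) (i j : Fin n) :
    Matrix l.StdTableau l.StdTableau K :=
  Matrix.of fun T' T =>
    hoefsmitCoeff α β T.1 i j * fillingVec K T.1 T' +
      (1 + hoefsmitCoeff α β T.1 i j) * fillingVec K (T.1.exchange i j) T'

/-- The image of the `k`-th generator (`T` for `k = 0`, `S_k` for `k ≥ 1`) in the Hoefsmit model. -/
noncomputable def hoefsmitGen (α β : K) (l : DoublePartition n) (k : Fin n) :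
    Matrix l.StdTableau l.StdTableau K :=
  if k.1 = 0 then hoefsmitT β l k
  else hoefsmitS α β l ⟨k.1 - 1, lt_of_le_of_lt (Nat.sub_le _ _) k.2⟩ k

/-! ### The matrices satisfy the defining relations -/

namespace HoefsmitAux

variable {l : DoublePartition n}

theorem card_comp (l : DoublePartition n) : (l.comp 0).card + (l.comp 1).card = n := l.card_add

theorem hook_le (μ : YoungDiagram) {c r : ℕ} (hc : (0, c) ∈ μ.cells) (hr : (r, 0) ∈ μ.cells) :
    c + r + 1 ≤ μ.card := by
  have hc' : c < (μ.row 0).card := by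
    rw [← YoungDiagram.rowLen_eq_card, ← YoungDiagram.mem_iff_lt_rowLen]; exact hc
  have hr' : r < (μ.col 0).card := by
    rw [← YoungDiagram.colLen_eq_card, ← YoungDiagram.mem_iff_lt_colLen]; exact hr
  have hu : (μ.row 0 ∪ μ.col 0).card ≤ μ.card := by
    apply Finset.card_le_card
    intro x hx
    rcases Finset.mem_union.1 hx with h | h
    · exact (YoungDiagram.mem_row_iff.1 h).1
    · exact (YoungDiagram.mem_col_iff.1 h).1
  have hi : (μ.row 0 ∩ μ.col 0).card ≤ 1 := by
    apply Finset.card_le_one.2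
    intro x hx y hy
    have h1 := (YoungDiagram.mem_row_iff.1 (Finset.mem_inter.1 hx).1).2
    have h2 := (YoungDiagram.mem_col_iff.1 (Finset.mem_inter.1 hx).2).2
    have h3 := (YoungDiagram.mem_row_iff.1 (Finset.mem_inter.1 hy).1).2
    have h4 := (YoungDiagram.mem_col_iff.1 (Finset.mem_inter.1 hy).2).2
    exact Prod.ext (h1.trans h3.symm) (h2.trans h4.symm)
  have := Finset.card_union_add_card_inter (μ.row 0) (μ.col 0)
  omega

theorem lt_iff {k : Fin 2} {a b : (l.comp k).cells} :
    ((⟨k, a⟩ : l.Box) < ⟨k, b⟩) ↔ a.1.1 ≤ b.1.1 ∧ a.1.2 ≤ b.1.2 ∧ a.1 ≠ b.1 := by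
  rw [Sigma.mk_lt_mk_iff, ← Subtype.coe_lt_coe, lt_iff_le_and_ne, Prod.le_def, and_assoc]

theorem mem_of_le {k : Fin 2} (b : (l.comp k).cells) {r c : ℕ} (hr : r ≤ b.1.1) (hc : c ≤ b.1.2) :
    (r, c) ∈ (l.comp k).cells :=
  (l.comp k).up_left_mem hr hc b.2

/-- Two boxes of a component with the same content differ by at least `3` in a standard tableau. -/
theorem sep {f : l.Filling} (hf : StrictMono f) {k : Fin 2} {a b : (l.comp k).cells} {d : ℕ}
    (hd : 0 < d) (h1 : b.1.1 = a.1.1 + d) (h2 : b.1.2 = a.1.2 + d) :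
    (f ⟨k, a⟩).1 + 3 ≤ (f ⟨k, b⟩).1 := by
  obtain ⟨⟨ar, ac⟩, ha⟩ := a
  obtain ⟨⟨br, bc⟩, hb⟩ := b
  simp only at h1 h2
  have hx := mem_of_le (l := l) ⟨(br, bc), hb⟩ (r := ar + 1) (c := ac) (by simp; omega)
    (by simp; omega)
  have hy := mem_of_le (l := l) ⟨(br, bc), hb⟩ (r := ar) (c := ac + 1) (by simp; omega)
    (by simp; omega)
  have q1 : f ⟨k, (ar, ac), ha⟩ < f ⟨k, (ar + 1, ac), hx⟩ := hf (lt_iff.2 (by simp))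
  have q2 : f ⟨k, (ar, ac), ha⟩ < f ⟨k, (ar, ac + 1), hy⟩ := hf (lt_iff.2 (by simp))
  have q3 : f ⟨k, (ar + 1, ac), hx⟩ < f ⟨k, (br, bc), hb⟩ := hf (lt_iff.2 (by simp; omega))
  have q4 : f ⟨k, (ar, ac + 1), hy⟩ < f ⟨k, (br, bc), hb⟩ := hf (lt_iff.2 (by simp; omega))
  have q5 : f ⟨k, (ar + 1, ac), hx⟩ ≠ f ⟨k, (ar, ac + 1), hy⟩ := by
    intro h
    have := f.injective h
    simp at this
  have q6 : (f ⟨k, (ar + 1, ac), hx⟩).1 ≠ (f ⟨k, (ar, ac + 1), hy⟩).1 := fun h => q5 (Fin.ext h)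
  simp only [Fin.lt_def] at q1 q2 q3 q4
  omega

theorem covers {f : l.Filling} (hf : StrictMono f) {k : Fin 2} {a b : (l.comp k).cells}
    (hab : (⟨k, a⟩ : l.Box) < ⟨k, b⟩) (h : (f ⟨k, b⟩).1 = (f ⟨k, a⟩).1 + 1) :
    (b.1.1 = a.1.1 ∧ b.1.2 = a.1.2 + 1) ∨ (b.1.1 = a.1.1 + 1 ∧ b.1.2 = a.1.2) := by
  obtain ⟨⟨ar, ac⟩, ha⟩ := a
  obtain ⟨⟨br, bc⟩, hb⟩ := b
  obtain ⟨h1, h2, h3⟩ := lt_iff.1 hab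
  simp only [ne_eq, Prod.mk.injEq] at h1 h2 h3 ⊢
  have key : ∀ r c, ar ≤ r → ac ≤ c → r ≤ br → c ≤ bc → (r = ar ∧ c = ac) ∨ (r = br ∧ c = bc) := by
    intro r c e1 e2 e3 e4
    by_contra hcon
    have hx := mem_of_le (l := l) ⟨(br, bc), hb⟩ (r := r) (c := c) e3 e4
    have q1 : f ⟨k, (ar, ac), ha⟩ < f ⟨k, (r, c), hx⟩ := hf (lt_iff.2 (by simp; omega))
    have q2 : f ⟨k, (r, c), hx⟩ < f ⟨k, (br, bc), hb⟩ := hf (lt_iff.2 (by simp; omega))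
    simp only [Fin.lt_def] at q1 q2
    omega
  have k1 := key ar bc le_rfl h2 h1 le_rfl
  by_cases hr : ar = br
  · have := key ar (ac + 1) le_rfl (by omega) h1 (by omega)
    omega
  · have := key (ar + 1) ac (by omega) le_rfl (by omega) h2
    omega

theorem not_std {f : l.Filling} (hf : StrictMono f) {i j : Fin n} (hij : j.1 = i.1 + 1)
    (h : ¬ StrictMono (f.exchange i j)) : ∃ A B : l.Box, A < B ∧ f A = i ∧ f B = j := by
  unfold StrictMono at h
  push Not at h
  obtain ⟨A, B, hAB, h⟩ := h
  refine ⟨A, B, hAB, ?_⟩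
  have hlt := hf hAB
  simp only [Filling.exchange, Equiv.trans_apply, Equiv.swap_apply_def] at h
  generalize f A = u at h hlt ⊢
  generalize f B = v at h hlt ⊢
  split_ifs at h <;> simp only [Fin.lt_def, Fin.le_def, Fin.ext_iff] at * <;> omega

theorem not_std_of {g : l.Filling} {A B : l.Box} (hAB : A < B) (h : g B ≤ g A) :
    ¬ StrictMono g := fun hg => absurd (hg hAB) (not_lt.2 h)

variable {α β : K}

theorem ct_ne_zero (h0 : α ≠ 0) (hβ0 : β ≠ 0) (b : l.Box) : boxContent α β b ≠ 0 := by
  unfold boxContent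
  split_ifs
  · exact mul_ne_zero hβ0 (zpow_ne_zero _ h0)
  · exact neg_ne_zero.2 (zpow_ne_zero _ h0)

theorem zpow_inj (hα : n < orderOf α) (h0 : α ≠ 0) {s t : ℤ} (h : α ^ s = α ^ t)
    (h1 : s - t < n) (h2 : t - s < n) : s = t := by
  have h3 : α ^ (s - t) = 1 := by
    rw [zpow_sub₀ h0, h, div_self (zpow_ne_zero _ h0)]
  have h4 : (orderOf α : ℤ) ∣ s - t := by
    have e : (Units.mk0 α h0) ^ (s - t) = 1 := by
      ext; simpa using h3
    have := orderOf_dvd_iff_zpow_eq_one.2 e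
    rwa [← orderOf_units, Units.val_mk0] at this
  have := Int.eq_zero_of_abs_lt_dvd h4 (by rw [abs_lt]; constructor <;> omega)
  omega

theorem bound_same {k : Fin 2} (a b : (l.comp k).cells) :
    ((a.1.2 : ℤ) - a.1.1) - ((b.1.2 : ℤ) - b.1.1) < n := by
  have h := hook_le (l.comp k) (mem_of_le a (Nat.zero_le _) le_rfl)
    (mem_of_le b le_rfl (Nat.zero_le _))
  have := card_comp l
  have : (l.comp k).card ≤ n := by
    fin_cases k <;> simp <;> omega
  omega

theorem bound_diff (a : (l.comp 0).cells) (b : (l.comp 1).cells) :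
    |((a.1.2 : ℤ) - a.1.1) - ((b.1.2 : ℤ) - b.1.1)| + 1 < n := by
  have h1 := hook_le (l.comp 0) (mem_of_le a (Nat.zero_le _) le_rfl)
    (mem_of_le a le_rfl (Nat.zero_le _))
  have h2 := hook_le (l.comp 1) (mem_of_le b (Nat.zero_le _) le_rfl)
    (mem_of_le b le_rfl (Nat.zero_le _))
  have := card_comp l
  have : |((a.1.2 : ℤ) - a.1.1) - ((b.1.2 : ℤ) - b.1.1)| < (n : ℤ) - 1 := by
    rw [abs_lt]; constructor <;> omega
  omega

theorem ct_ne_cross (h0 : α ≠ 0) (hβ : ∀ i : ℤ, |i| ≤ (n : ℤ) - 1 → β ≠ -α ^ i)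
    (a : (l.comp 0).cells) (b : (l.comp 1).cells) :
    boxContent α β (⟨0, a⟩ : l.Box) ≠ boxContent α β (⟨1, b⟩ : l.Box) := by
  intro h
  simp only [boxContent, Box.row, Box.col, if_true, one_ne_zero, if_false] at h
  have hb := bound_diff a b
  refine hβ (((b.1.2 : ℤ) - b.1.1) - ((a.1.2 : ℤ) - a.1.1)) (by rw [abs_sub_comm]; omega) ?_
  rw [zpow_sub₀ h0 ((b.1.2 : ℤ) - b.1.1), ← neg_div, ← h,
    mul_div_cancel_right₀ _ (zpow_ne_zero _ h0)]

theorem ct_ne (hα : n < orderOf α) (h0 : α ≠ 0) (hβ0 : β ≠ 0)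
    (hβ : ∀ i : ℤ, |i| ≤ (n : ℤ) - 1 → β ≠ -α ^ i)
    {f : l.Filling} (hf : StrictMono f) {i j : Fin n} (h1 : i.1 < j.1) (h2 : j.1 ≤ i.1 + 2) :
    boxContent α β (f.symm i) ≠ boxContent α β (f.symm j) := by
  obtain ⟨ki, a, ha⟩ : ∃ k a, f.symm i = ⟨k, a⟩ := ⟨_, _, rfl⟩
  obtain ⟨kj, b, hb⟩ : ∃ k a, f.symm j = ⟨k, a⟩ := ⟨_, _, rfl⟩
  have ea : f ⟨ki, a⟩ = i := by rw [← ha, Equiv.apply_symm_apply]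
  have eb : f ⟨kj, b⟩ = j := by rw [← hb, Equiv.apply_symm_apply]
  rw [ha, hb]
  by_cases hk : ki = kj
  · subst hk
    intro h
    have h' : α ^ ((a.1.2 : ℤ) - a.1.1) = α ^ ((b.1.2 : ℤ) - b.1.1) := by
      simp only [boxContent, Box.row, Box.col] at h
      split_ifs at h
      · exact mul_left_cancel₀ hβ0 h
      · exact neg_injective h
    have e := zpow_inj hα h0 h' (bound_same a b) (bound_same b a)
    rcases lt_trichotomy a.1.1 b.1.1 with hlt | heq | hgt
    · have := sep hf (a := a) (b := b) (d := b.1.1 - a.1.1) (by omega) (by omega) (by omega)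
      rw [ea, eb] at this
      omega
    · have : a = b := Subtype.ext (Prod.ext heq (by omega))
      subst this
      rw [ea] at eb
      subst eb
      omega
    · have := sep hf (a := b) (b := a) (d := a.1.1 - b.1.1) (by omega) (by omega) (by omega)
      rw [ea, eb] at this
      omega
  · have : (ki = 0 ∧ kj = 1) ∨ (ki = 1 ∧ kj = 0) := by
      have h2 : ∀ x y : Fin 2, x ≠ y → (x = 0 ∧ y = 1) ∨ (x = 1 ∧ y = 0) := by decide
      exact h2 _ _ hk
    rcases this with ⟨rfl, rfl⟩ | ⟨rfl, rfl⟩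
    · exact ct_ne_cross h0 hβ a b
    · exact (ct_ne_cross h0 hβ b a).symm

/-- If `i` and `j = i + 1` cannot be exchanged, their contents have ratio `α` or `α⁻¹`. -/
theorem ct_adj (h0 : α ≠ 0) {f : l.Filling} (hf : StrictMono f) {i j : Fin n}
    (hij : j.1 = i.1 + 1) (h : ¬ StrictMono (f.exchange i j)) :
    boxContent α β (f.symm j) = α * boxContent α β (f.symm i) ∨
      boxContent α β (f.symm i) = α * boxContent α β (f.symm j) := by
  obtain ⟨⟨k, a⟩, ⟨k', b⟩, hAB, hA, hB⟩ := not_std hf hij h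
  obtain rfl : k = k' := (Sigma.lt_def.1 hAB).1
  have hc := covers hf hAB (by rw [hA, hB, hij])
  rw [← hA, ← hB, Equiv.symm_apply_apply, Equiv.symm_apply_apply]
  simp only [boxContent, Box.row, Box.col]
  rcases hc with ⟨e1, e2⟩ | ⟨e1, e2⟩
  · left
    have : ((b.1.2 : ℤ) - b.1.1) = ((a.1.2 : ℤ) - a.1.1) + 1 := by omega
    rw [this, zpow_add_one₀ h0]
    split_ifs <;> ring
  · right
    have : ((a.1.2 : ℤ) - a.1.1) = ((b.1.2 : ℤ) - b.1.1) + 1 := by omega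
    rw [this, zpow_add_one₀ h0]
    split_ifs <;> ring

/-! #### Action on basis vectors -/

theorem fillingVec_eq_zero {g : l.Filling} (h : ¬ StrictMono g) : fillingVec K g = 0 := by
  funext T
  simp only [fillingVec, Pi.zero_apply, ite_eq_right_iff, one_ne_zero, imp_false]
  rintro rfl
  exact h T.2

theorem mulVec_fillingVec (M : Matrix l.StdTableau l.StdTableau K) (T : l.StdTableau) :
    M *ᵥ fillingVec K T.1 = M.col T := by
  have : fillingVec K T.1 = Pi.single T 1 := by
    funext T'
    by_cases h : T' = T
    · subst h; simp [fillingVec]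
    · have h' : T'.1 ≠ T.1 := fun e => h (Subtype.ext e)
      simp [fillingVec, h, h']
  rw [this, Matrix.mulVec_single_one]

theorem ext_fillingVec {M N : Matrix l.StdTableau l.StdTableau K}
    (h : ∀ f : l.Filling, StrictMono f → M *ᵥ fillingVec K f = N *ᵥ fillingVec K f) : M = N := by
  ext T' T
  have := h T.1 T.2
  rw [mulVec_fillingVec, mulVec_fillingVec] at this
  exact congrFun this T'

theorem exchange_symm (f : l.Filling) (i j x : Fin n) :
    (f.exchange i j).symm x = f.symm (Equiv.swap i j x) := by
  simp [Filling.exchange]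

theorem exchange_exchange (f : l.Filling) (i j : Fin n) : (f.exchange i j).exchange i j = f := by
  ext x; simp [Filling.exchange]

theorem exchange_apply (f : l.Filling) (i j : Fin n) (b : l.Box) :
    f.exchange i j b = Equiv.swap i j (f b) := rfl

theorem act_std {f : l.Filling} (hf : StrictMono f) (i j : Fin n) :
    hoefsmitS α β l i j *ᵥ fillingVec K f =
      hoefsmitCoeff α β f i j • fillingVec K f +
        (1 + hoefsmitCoeff α β f i j) • fillingVec K (f.exchange i j) := by
  have := mulVec_fillingVec (hoefsmitS α β l i j) ⟨f, hf⟩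
  simp only at this
  rw [this]
  rfl

theorem act_of {f : l.Filling} {i j : Fin n} (h : StrictMono f ∨ ¬ StrictMono (f.exchange i j)) :
    hoefsmitS α β l i j *ᵥ fillingVec K f =
      hoefsmitCoeff α β f i j • fillingVec K f +
        (1 + hoefsmitCoeff α β f i j) • fillingVec K (f.exchange i j) := by
  by_cases hf : StrictMono f
  · exact act_std hf i j
  · have h' := h.resolve_left hf
    rw [fillingVec_eq_zero hf, fillingVec_eq_zero h']
    simp

/-- The coefficient, as a function of the two contents. -/
theorem coeff_eq {x y : K} (hy : y ≠ 0) (hxy : x ≠ y) :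
    (α - 1) / (1 - x / y) = (α - 1) * y / (y - x) := by
  have h1 : y - x ≠ 0 := sub_ne_zero.2 hxy.symm
  have h2 : 1 - x / y = (y - x) / y := by field_simp
  rw [h2, div_div_eq_mul_div]

theorem ne_zero_of (hα : n < orderOf α) : α ≠ 0 := by
  rintro rfl
  simp at hα

theorem act_back (hα : n < orderOf α) (hβ0 : β ≠ 0) (hβ : ∀ i : ℤ, |i| ≤ (n : ℤ) - 1 → β ≠ -α ^ i)
    {f : l.Filling} (hf : StrictMono f) {i j : Fin n} (hij : j.1 = i.1 + 1) :
    (1 + hoefsmitCoeff α β f i j) •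
        hoefsmitS α β l i j *ᵥ fillingVec K (f.exchange i j) =
      (1 + hoefsmitCoeff α β f i j) •
        (hoefsmitCoeff α β f j i • fillingVec K (f.exchange i j) +
          (1 + hoefsmitCoeff α β f j i) • fillingVec K f) := by
  have h0 := ne_zero_of hα
  by_cases h : StrictMono (f.exchange i j)
  · rw [act_std h, exchange_exchange]
    simp [hoefsmitCoeff, exchange_symm]
  · rw [fillingVec_eq_zero h, Matrix.mulVec_zero, smul_zero, smul_zero, zero_add, smul_smul]
    have hne := ct_ne hα h0 hβ0 hβ hf (i := i) (j := j) (by omega) (by omega)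
    have hx := ct_ne_zero (l := l) h0 hβ0 (f.symm i)
    have hy := ct_ne_zero (l := l) h0 hβ0 (f.symm j)
    have hadj := ct_adj (β := β) h0 hf hij h
    have : (1 + hoefsmitCoeff α β f i j) * (1 + hoefsmitCoeff α β f j i) = 0 := by
      unfold hoefsmitCoeff
      rw [coeff_eq hy hne, coeff_eq hx hne.symm]
      generalize boxContent α β (f.symm i) = x at *
      generalize boxContent α β (f.symm j) = y at *
      have h1 : y - x ≠ 0 := sub_ne_zero.2 hne.symm
      have h2 : x - y ≠ 0 := sub_ne_zero.2 hne
      have e1 : 1 + (α - 1) * y / (y - x) = (α * y - x) / (y - x) := by field_simp; ring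
      have e2 : 1 + (α - 1) * x / (x - y) = (α * x - y) / (x - y) := by field_simp; ring
      rw [e1, e2]
      rcases hadj with h | h <;> rw [h] <;> simp
    rw [this, zero_smul]

theorem coeff_swap (hα : n < orderOf α) (hβ0 : β ≠ 0)
    (hβ : ∀ i : ℤ, |i| ≤ (n : ℤ) - 1 → β ≠ -α ^ i)
    {f : l.Filling} (hf : StrictMono f) {i j : Fin n} (hij : j.1 = i.1 + 1) :
    hoefsmitCoeff α β f j i = α - 1 - hoefsmitCoeff α β f i j := by
  have h0 := ne_zero_of hα
  have hne := ct_ne hα h0 hβ0 hβ hf (i := i) (j := j) (by omega) (by omega)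
  have hx := ct_ne_zero (l := l) h0 hβ0 (f.symm i)
  have hy := ct_ne_zero (l := l) h0 hβ0 (f.symm j)
  unfold hoefsmitCoeff
  rw [coeff_eq hy hne, coeff_eq hx hne.symm]
  generalize boxContent α β (f.symm i) = x at *
  generalize boxContent α β (f.symm j) = y at *
  have h1 : y - x ≠ 0 := sub_ne_zero.2 hne.symm
  have h2 : x - y = -(y - x) := by ring
  rw [h2]
  field_simp
  ring

theorem quadratic (hα : n < orderOf α) (hβ0 : β ≠ 0)
    (hβ : ∀ i : ℤ, |i| ≤ (n : ℤ) - 1 → β ≠ -α ^ i) {i j : Fin n} (hij : j.1 = i.1 + 1) :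
    hoefsmitS α β l i j * hoefsmitS α β l i j = (α - 1) • hoefsmitS α β l i j + α • 1 := by
  apply ext_fillingVec
  intro f hf
  have hsum := coeff_swap hα hβ0 hβ hf hij
  have hb := act_back hα hβ0 hβ hf hij
  rw [← Matrix.mulVec_mulVec, act_std hf, Matrix.mulVec_add, Matrix.mulVec_smul,
    Matrix.mulVec_smul, hb, Matrix.add_mulVec, Matrix.smul_mulVec, Matrix.smul_mulVec,
    Matrix.one_mulVec, act_std hf, hsum]
  match_scalars <;> ring

theorem braid (hα : n < orderOf α) (hβ0 : β ≠ 0)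
    (hβ : ∀ i : ℤ, |i| ≤ (n : ℤ) - 1 → β ≠ -α ^ i) {a b c : Fin n} (hab : b.1 = a.1 + 1)
    (hbc : c.1 = b.1 + 1) :
    hoefsmitS α β l a b * hoefsmitS α β l b c * hoefsmitS α β l a b =
      hoefsmitS α β l b c * hoefsmitS α β l a b * hoefsmitS α β l b c := by
  have h0 := ne_zero_of hα
  have ab : a ≠ b := fun h => by rw [h] at hab; omega
  have bc : b ≠ c := fun h => by rw [h] at hbc; omega
  have ac : a ≠ c := fun h => by rw [← h] at hbc; omega
  have hac : a ≤ c := by rw [Fin.le_def]; omega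
  have lab : a ≤ b := by rw [Fin.le_def]; omega
  have lbc : b ≤ c := by rw [Fin.le_def]; omega
  have s1 : Equiv.swap a b c = c := Equiv.swap_apply_of_ne_of_ne ac.symm bc.symm
  have s2 : Equiv.swap b c a = a := Equiv.swap_apply_of_ne_of_ne ab ac
  apply ext_fillingVec
  intro f hf
  set S := hoefsmitS α β l a b with hS
  set S' := hoefsmitS α β l b c with hS'
  set g1 := f.exchange a b with hg1
  set g2 := f.exchange b c with hg2
  set g12 := g1.exchange b c with hg12
  set g21 := g2.exchange a b with hg21
  have P1 : StrictMono g1 ∨ ¬ StrictMono g12 := by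
    by_contra! hcon
    obtain ⟨A, B, hAB, hA, hB⟩ := not_std hf hab hcon.1
    exact not_std_of hAB (by simp [hg12, hg1, exchange_apply, hA, hB, s2, hac]) hcon.2
  have P2 : StrictMono g12 ∨ ¬ StrictMono (g12.exchange a b) := by
    by_contra! hcon
    by_cases h1 : StrictMono g1
    · obtain ⟨A, B, hAB, hA, hB⟩ := not_std h1 hbc hcon.1
      refine not_std_of hAB ?_ hcon.2
      change Equiv.swap a b (Equiv.swap b c (g1 B)) ≤ Equiv.swap a b (Equiv.swap b c (g1 A))
      rw [hA, hB]
      simp [s1, hac]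
    · obtain ⟨A, B, hAB, hA, hB⟩ := not_std hf hab h1
      exact not_std_of hAB (by simp [hg12, hg1, exchange_apply, hA, hB, s1, s2, lbc]) hcon.2
  have P3 : StrictMono g2 ∨ ¬ StrictMono g21 := by
    by_contra! hcon
    obtain ⟨A, B, hAB, hA, hB⟩ := not_std hf hbc hcon.1
    exact not_std_of hAB (by simp [hg21, hg2, exchange_apply, hA, hB, s1, hac]) hcon.2
  have P4 : StrictMono g21 ∨ ¬ StrictMono (g21.exchange b c) := by
    by_contra! hcon
    by_cases h1 : StrictMono g2
    · obtain ⟨A, B, hAB, hA, hB⟩ := not_std h1 hab hcon.1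
      refine not_std_of hAB ?_ hcon.2
      change Equiv.swap b c (Equiv.swap a b (g2 B)) ≤ Equiv.swap b c (Equiv.swap a b (g2 A))
      rw [hA, hB]
      simp [s2, hac]
    · obtain ⟨A, B, hAB, hA, hB⟩ := not_std hf hbc h1
      exact not_std_of hAB (by simp [hg21, hg2, exchange_apply, hA, hB, s1, s2, lab]) hcon.2
  have hw : g21.exchange b c = g12.exchange a b := by
    apply Equiv.ext
    intro x
    simp only [hg12, hg21, hg1, hg2, exchange_apply]
    generalize f x = u
    by_cases ua : u = a
    · subst ua; simp [s1, s2]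
    by_cases ub : u = b
    · subst ub; simp [s1, s2]
    by_cases uc : u = c
    · subst uc; simp [s1, s2]
    simp [Equiv.swap_apply_of_ne_of_ne, ua, ub, uc]
  have cxy := ct_ne hα h0 hβ0 hβ hf (i := a) (j := b) (by omega) (by omega)
  have cyz := ct_ne hα h0 hβ0 hβ hf (i := b) (j := c) (by omega) (by omega)
  have cxz := ct_ne hα h0 hβ0 hβ hf (i := a) (j := c) (by omega) (by omega)
  have hy := ct_ne_zero (l := l) h0 hβ0 (f.symm b)
  have hz := ct_ne_zero (l := l) h0 hβ0 (f.symm c)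
  have e1 : hoefsmitCoeff α β g1 b c = hoefsmitCoeff α β f a c := by
    simp [hoefsmitCoeff, hg1, exchange_symm, s1]
  have e2 : hoefsmitCoeff α β g2 a b = hoefsmitCoeff α β f a c := by
    simp [hoefsmitCoeff, hg2, exchange_symm, s2]
  have e3 : hoefsmitCoeff α β g12 a b = hoefsmitCoeff α β f b c := by
    simp [hoefsmitCoeff, hg1, hg12, exchange_symm, s1, s2]
  have e4 : hoefsmitCoeff α β g21 b c = hoefsmitCoeff α β f a b := by
    simp [hoefsmitCoeff, hg2, hg21, exchange_symm, s1, s2]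
  have rel : hoefsmitCoeff α β f a b * hoefsmitCoeff α β f b c +
      hoefsmitCoeff α β f a c * (α - 1) =
      hoefsmitCoeff α β f a c * (hoefsmitCoeff α β f a b + hoefsmitCoeff α β f b c) := by
    unfold hoefsmitCoeff
    rw [coeff_eq hy cxy, coeff_eq hz cyz, coeff_eq hz cxz]
    generalize boxContent α β (f.symm a) = x at *
    generalize boxContent α β (f.symm b) = y at *
    generalize boxContent α β (f.symm c) = z at *
    have h1 : y - x ≠ 0 := sub_ne_zero.2 cxy.symm
    have h2 : z - y ≠ 0 := sub_ne_zero.2 cyz.symm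
    have h3 : z - x ≠ 0 := sub_ne_zero.2 cxz.symm
    field_simp
    ring
  have a1 := act_std (α := α) (β := β) hf a b
  have a2 := act_std (α := α) (β := β) hf b c
  have a3 := act_of (α := α) (β := β) P1
  have a4 := act_of (α := α) (β := β) P2
  have a5 := act_of (α := α) (β := β) P3
  have a6 := act_of (α := α) (β := β) P4
  have b1 := act_back hα hβ0 hβ hf hab
  have b2 := act_back hα hβ0 hβ hf hbc
  rw [coeff_swap hα hβ0 hβ hf hab] at b1
  rw [coeff_swap hα hβ0 hβ hf hbc] at b2
  rw [e1] at a3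
  rw [e3] at a4
  rw [e2] at a5
  rw [e4, hw] at a6
  simp only [← hS, ← hS', ← hg1, ← hg2, ← hg12, ← hg21] at a1 a2 a3 a4 a5 a6 b1 b2
  simp only [← Matrix.mulVec_mulVec]
  generalize hoefsmitCoeff α β f a b = p at *
  generalize hoefsmitCoeff α β f b c = q at *
  generalize hoefsmitCoeff α β f a c = r at *
  have L : S *ᵥ S' *ᵥ S *ᵥ fillingVec K f =
      (p * q) • S *ᵥ fillingVec K f + (p * (1 + q)) • S *ᵥ fillingVec K g2 +
        r • ((1 + p) • S *ᵥ fillingVec K g1) +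
        ((1 + p) * (1 + r)) • S *ᵥ fillingVec K g12 := by
    conv_lhs => rw [a1]
    simp only [Matrix.mulVec_add, Matrix.mulVec_smul, a2, a3]
    module
  have R : S' *ᵥ S *ᵥ S' *ᵥ fillingVec K f =
      (p * q) • S' *ᵥ fillingVec K f + (q * (1 + p)) • S' *ᵥ fillingVec K g1 +
        r • ((1 + q) • S' *ᵥ fillingVec K g2) +
        ((1 + q) * (1 + r)) • S' *ᵥ fillingVec K g21 := by
    conv_lhs => rw [a2]
    simp only [Matrix.mulVec_add, Matrix.mulVec_smul, a1, a5]
    module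
  rw [L, R, b1, b2, a1, a2, a3, a4, a5, a6]
  match_scalars
  · linear_combination (p - q) * rel
  all_goals first
    | ring1
    | linear_combination (1 + p) * rel
    | linear_combination (-(1 + q)) * rel

theorem far_comm {a b c d : Fin n} (hab : b.1 = a.1 + 1) (hcd : d.1 = c.1 + 1) (hbc : b.1 < c.1) :
    hoefsmitS α β l a b * hoefsmitS α β l c d = hoefsmitS α β l c d * hoefsmitS α β l a b := by
  have nac : a ≠ c := fun h => by rw [h] at hab; omega
  have nad : a ≠ d := fun h => by rw [h] at hab; omega
  have nbc : b ≠ c := fun h => by rw [h] at hbc; omega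
  have nbd : b ≠ d := fun h => by rw [h] at hbc; omega
  have lab : a ≤ b := by rw [Fin.le_def]; omega
  have lcd : c ≤ d := by rw [Fin.le_def]; omega
  have s1 : Equiv.swap a b c = c := Equiv.swap_apply_of_ne_of_ne nac.symm nbc.symm
  have s2 : Equiv.swap a b d = d := Equiv.swap_apply_of_ne_of_ne nad.symm nbd.symm
  have s3 : Equiv.swap c d a = a := Equiv.swap_apply_of_ne_of_ne nac nad
  have s4 : Equiv.swap c d b = b := Equiv.swap_apply_of_ne_of_ne nbc nbd
  apply ext_fillingVec
  intro f hf
  have P1 : StrictMono (f.exchange a b) ∨ ¬ StrictMono ((f.exchange a b).exchange c d) := by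
    by_contra! hcon
    obtain ⟨A, B, hAB, hA, hB⟩ := not_std hf hab hcon.1
    exact not_std_of hAB (by simp [exchange_apply, hA, hB, s3, s4, lab]) hcon.2
  have P2 : StrictMono (f.exchange c d) ∨ ¬ StrictMono ((f.exchange c d).exchange a b) := by
    by_contra! hcon
    obtain ⟨A, B, hAB, hA, hB⟩ := not_std hf hcd hcon.1
    exact not_std_of hAB (by simp [exchange_apply, hA, hB, s1, s2, lcd]) hcon.2
  have hw : (f.exchange c d).exchange a b = (f.exchange a b).exchange c d := by
    apply Equiv.ext
    intro x
    simp only [exchange_apply]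
    generalize f x = u
    by_cases ua : u = a
    · subst ua; simp [s3, s4]
    by_cases ub : u = b
    · subst ub; simp [s3, s4]
    by_cases uc : u = c
    · subst uc; simp [s1, s2]
    by_cases ud : u = d
    · subst ud; simp [s1, s2]
    simp [Equiv.swap_apply_of_ne_of_ne, ua, ub, uc, ud]
  have e1 : hoefsmitCoeff α β (f.exchange a b) c d = hoefsmitCoeff α β f c d := by
    simp [hoefsmitCoeff, exchange_symm, s1, s2]
  have e2 : hoefsmitCoeff α β (f.exchange c d) a b = hoefsmitCoeff α β f a b := by
    simp [hoefsmitCoeff, exchange_symm, s3, s4]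
  have a3 := act_of (α := α) (β := β) P1
  have a4 := act_of (α := α) (β := β) P2
  rw [← Matrix.mulVec_mulVec, ← Matrix.mulVec_mulVec, act_std hf, act_std hf]
  simp only [Matrix.mulVec_add, Matrix.mulVec_smul, a3, a4, act_std hf, e1, e2, hw]
  module

theorem act_T (i : Fin n) (g : l.Filling) :
    hoefsmitT β l i *ᵥ fillingVec K g =
      (if (g.symm i).1 = 0 then β else -1) • fillingVec K g := by
  funext T
  simp only [hoefsmitT, Matrix.mulVec_diagonal, Pi.smul_apply, smul_eq_mul]
  by_cases h : T.1 = g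
  · rw [h]
  · simp [fillingVec, h]

theorem T_comm {i a b : Fin n} (ha : i ≠ a) (hb : i ≠ b) :
    hoefsmitT β l i * hoefsmitS α β l a b = hoefsmitS α β l a b * hoefsmitT β l i := by
  apply ext_fillingVec
  intro f hf
  rw [← Matrix.mulVec_mulVec, ← Matrix.mulVec_mulVec, act_T, Matrix.mulVec_smul, act_std hf]
  simp only [Matrix.mulVec_add, Matrix.mulVec_smul, act_T, exchange_symm,
    Equiv.swap_apply_of_ne_of_ne ha hb]
  module

theorem origin {f : l.Filling} (hf : StrictMono f) {k : Fin 2} {a : (l.comp k).cells}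
    (ha : (a.1.1, a.1.2) ≠ (0, 0)) :
    ∃ o : (l.comp k).cells, f ⟨k, o⟩ < f ⟨k, a⟩ :=
  ⟨⟨(0, 0), mem_of_le a (Nat.zero_le _) (Nat.zero_le _)⟩,
    hf (lt_iff.2 ⟨Nat.zero_le _, Nat.zero_le _, fun h => ha h.symm⟩)⟩

theorem braid_four (hα : n < orderOf α) (hβ0 : β ≠ 0)
    (hβ : ∀ i : ℤ, |i| ≤ (n : ℤ) - 1 → β ≠ -α ^ i) {a b : Fin n} (ha : a.1 = 0) (hb : b.1 = 1) :
    hoefsmitT β l a * hoefsmitS α β l a b * hoefsmitT β l a * hoefsmitS α β l a b =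
      hoefsmitS α β l a b * hoefsmitT β l a * hoefsmitS α β l a b * hoefsmitT β l a := by
  have h0 := ne_zero_of hα
  apply ext_fillingVec
  intro f hf
  have hab : b.1 = a.1 + 1 := by omega
  have rel : ((if (f.symm a).1 = 0 then β else -1) - (if (f.symm b).1 = 0 then β else -1)) *
      ((if (f.symm a).1 = 0 then β else -1) * hoefsmitCoeff α β f a b +
        (if (f.symm b).1 = 0 then β else -1) * hoefsmitCoeff α β f b a) = 0 := by
    by_cases hk : (f.symm a).1 = (f.symm b).1
    · rw [hk]; simp
    · have ca : boxContent α β (f.symm a) = if (f.symm a).1 = 0 then β else -1 := by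
        obtain ⟨k, x, hx⟩ : ∃ k x, f.symm a = ⟨k, x⟩ := ⟨_, _, rfl⟩
        have ex : f ⟨k, x⟩ = a := by rw [← hx, Equiv.apply_symm_apply]
        have : (x.1.1, x.1.2) = (0, 0) := by
          by_contra hne
          obtain ⟨o, ho⟩ := origin hf hne
          rw [ex, Fin.lt_def] at ho
          omega
        simp only [Prod.mk.injEq] at this
        rw [hx]
        simp [boxContent, Box.row, Box.col, this.1, this.2]
      have cb : boxContent α β (f.symm b) = if (f.symm b).1 = 0 then β else -1 := by
        obtain ⟨k, x, hx⟩ : ∃ k x, f.symm b = ⟨k, x⟩ := ⟨_, _, rfl⟩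
        have ex : f ⟨k, x⟩ = b := by rw [← hx, Equiv.apply_symm_apply]
        have : (x.1.1, x.1.2) = (0, 0) := by
          by_contra hne
          obtain ⟨o, ho⟩ := origin hf hne
          rw [ex, Fin.lt_def] at ho
          have : f ⟨k, o⟩ = a := Fin.ext (by omega)
          rw [← this, hx, Equiv.symm_apply_apply] at hk
          exact hk rfl
        simp only [Prod.mk.injEq] at this
        rw [hx]
        simp [boxContent, Box.row, Box.col, this.1, this.2]
      have hne := ct_ne hα h0 hβ0 hβ hf (i := a) (j := b) (by omega) (by omega)
      have hx := ct_ne_zero (l := l) h0 hβ0 (f.symm a)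
      have hy := ct_ne_zero (l := l) h0 hβ0 (f.symm b)
      rw [← ca, ← cb]
      unfold hoefsmitCoeff
      rw [coeff_eq hy hne, coeff_eq hx hne.symm]
      generalize boxContent α β (f.symm a) = x at *
      generalize boxContent α β (f.symm b) = y at *
      have h1 : y - x ≠ 0 := sub_ne_zero.2 hne.symm
      have h2 : x - y = -(y - x) := by ring
      rw [h2]
      field_simp
      ring
  have b1 := act_back hα hβ0 hβ hf hab
  have a1 := act_std (α := α) (β := β) hf a b
  have t0 := act_T (β := β) a f
  have t1 := act_T (β := β) a (f.exchange a b)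
  rw [exchange_symm, Equiv.swap_apply_left] at t1
  simp only [← Matrix.mulVec_mulVec]
  generalize hoefsmitCoeff α β f a b = p at *
  generalize hoefsmitCoeff α β f b a = p' at *
  generalize (if (f.symm a).1 = 0 then β else -1) = x at *
  generalize (if (f.symm b).1 = 0 then β else -1) = y at *
  generalize hoefsmitS α β l a b = S at *
  generalize hoefsmitT β l a = T at *
  generalize fillingVec K f = v at *
  generalize fillingVec K (f.exchange a b) = w at *
  have M : S *ᵥ T *ᵥ S *ᵥ v = (x * p) • S *ᵥ v + y • ((1 + p) • S *ᵥ w) := by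
    conv_lhs => rw [a1]
    simp only [Matrix.mulVec_add, Matrix.mulVec_smul, t0, t1]
    module
  conv_rhs at M => rw [b1, a1]
  rw [t0]
  simp only [Matrix.mulVec_smul]
  rw [M]
  simp only [Matrix.mulVec_add, Matrix.mulVec_smul, t0, t1]
  match_scalars
  · ring
  · linear_combination (-(1 + p)) * rel

theorem isUnit_gen (hα : n < orderOf α) (hβ0 : β ≠ 0)
    (hβ : ∀ i : ℤ, |i| ≤ (n : ℤ) - 1 → β ≠ -α ^ i) (l : DoublePartition n) (k : Fin n) :
    IsUnit (hoefsmitGen α β l k) := by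
  have h0 := ne_zero_of hα
  unfold hoefsmitGen
  split_ifs with hk
  · rw [Matrix.isUnit_iff_isUnit_det, hoefsmitT, Matrix.det_diagonal, isUnit_iff_ne_zero,
      Finset.prod_ne_zero_iff]
    intro T _
    split_ifs
    · exact hβ0
    · exact neg_ne_zero.2 one_ne_zero
  · set S := hoefsmitS α β l ⟨k.1 - 1, lt_of_le_of_lt (Nat.sub_le _ _) k.2⟩ k with hS
    have hq : S * S = (α - 1) • S + α • 1 :=
      quadratic hα hβ0 hβ (show k.1 = (k.1 - 1) + 1 by omega)
    apply IsUnit.of_mul_eq_one (α⁻¹ • (S - (α - 1) • 1))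
    rw [Matrix.mul_smul, mul_sub, hq, Matrix.mul_smul, mul_one, add_sub_cancel_left, smul_smul,
      inv_mul_cancel₀ h0, one_smul]

end HoefsmitAux

/-- The defining relations of the Artin group of type `B_n`; the generator `0` is `T = S_0`. -/
def artinBRels (n : ℕ) : Set (FreeGroup (Fin n)) :=
  {r | ∃ i j : Fin n, i.1 = 0 ∧ j.1 = 1 ∧
      r = FreeGroup.of i * FreeGroup.of j * FreeGroup.of i * FreeGroup.of j *
        (FreeGroup.of j * FreeGroup.of i * FreeGroup.of j * FreeGroup.of i)⁻¹} ∪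
  {r | ∃ i j : Fin n, 1 ≤ i.1 ∧ j.1 = i.1 + 1 ∧
      r = FreeGroup.of i * FreeGroup.of j * FreeGroup.of i *
        (FreeGroup.of j * FreeGroup.of i * FreeGroup.of j)⁻¹} ∪
  {r | ∃ i j : Fin n, i.1 + 2 ≤ j.1 ∧
      r = FreeGroup.of i * FreeGroup.of j * (FreeGroup.of j * FreeGroup.of i)⁻¹}

/-- The Artin group of type `B_n`. -/
abbrev ArtinB (n : ℕ) : Type :=
  PresentedGroup (artinBRels n)

variable {α β : K}

/-- The generators of the Hoefsmit model as invertible matrices. -/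
noncomputable def hoefsmitUnit (hα : n < orderOf α) (hβ0 : β ≠ 0)
    (hβ : ∀ i : ℤ, |i| ≤ (n : ℤ) - 1 → β ≠ -α ^ i) (l : DoublePartition n) (k : Fin n) :
    GL l.StdTableau K :=
  (HoefsmitAux.isUnit_gen hα hβ0 hβ l k).unit

theorem hoefsmitUnit_rels (hα : n < orderOf α) (hβ0 : β ≠ 0)
    (hβ : ∀ i : ℤ, |i| ≤ (n : ℤ) - 1 → β ≠ -α ^ i) (l : DoublePartition n) :
    ∀ r ∈ artinBRels n, FreeGroup.lift (hoefsmitUnit hα hβ0 hβ l) r = 1 := by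
  have hval : ∀ k, (hoefsmitUnit hα hβ0 hβ l k : Matrix l.StdTableau l.StdTableau K) =
      hoefsmitGen α β l k := fun k => rfl
  rintro r ((⟨i, j, hi, hj, rfl⟩ | ⟨i, j, hi, hj, rfl⟩) | ⟨i, j, hij, rfl⟩)
  · simp only [map_mul, map_inv, FreeGroup.lift_apply_of, mul_inv_eq_one]
    apply Units.ext
    simp only [Units.val_mul, hval]
    have hp : (⟨j.1 - 1, lt_of_le_of_lt (Nat.sub_le _ _) j.2⟩ : Fin n) = i := Fin.ext (by simp; omega)
    rw [hoefsmitGen, if_pos hi, hoefsmitGen, if_neg (by omega), hp]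
    exact HoefsmitAux.braid_four hα hβ0 hβ hi hj
  · simp only [map_mul, map_inv, FreeGroup.lift_apply_of, mul_inv_eq_one]
    apply Units.ext
    simp only [Units.val_mul, hval]
    have hp : (⟨j.1 - 1, lt_of_le_of_lt (Nat.sub_le _ _) j.2⟩ : Fin n) = i := Fin.ext (by simp; omega)
    rw [hoefsmitGen, if_neg (by omega), hoefsmitGen, if_neg (by omega), hp]
    exact HoefsmitAux.braid hα hβ0 hβ (show i.1 = (i.1 - 1) + 1 by omega) hj
  · simp only [map_mul, map_inv, FreeGroup.lift_apply_of, mul_inv_eq_one]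
    apply Units.ext
    simp only [Units.val_mul, hval]
    by_cases hi : i.1 = 0
    · rw [hoefsmitGen, if_pos hi, hoefsmitGen, if_neg (by omega)]
      refine HoefsmitAux.T_comm ?_ ?_ <;> rw [ne_eq, Fin.ext_iff] <;> (try dsimp only) <;> omega
    · rw [hoefsmitGen, if_neg hi, hoefsmitGen, if_neg (by omega)]
      exact HoefsmitAux.far_comm (show i.1 = (i.1 - 1) + 1 by omega)
        (show j.1 = (j.1 - 1) + 1 by omega) (show i.1 < j.1 - 1 by omega)

/-- The representation `R_l` of the Artin group of type `B_n` in the Hoefsmit model. -/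
noncomputable def hoefsmitRep (hα : n < orderOf α) (hβ0 : β ≠ 0)
    (hβ : ∀ i : ℤ, |i| ≤ (n : ℤ) - 1 → β ≠ -α ^ i) (l : DoublePartition n) :
    ArtinB n →* GL l.StdTableau K :=
  PresentedGroup.toGroup (hoefsmitUnit_rels hα hβ0 hβ l)

/-- The restriction of `R_l` to the derived subgroup of the Artin group. -/
noncomputable def hoefsmitRepDerived (hα : n < orderOf α) (hβ0 : β ≠ 0)
    (hβ : ∀ i : ℤ, |i| ≤ (n : ℤ) - 1 → β ≠ -α ^ i) (l : DoublePartition n) :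
    commutator (ArtinB n) →* GL l.StdTableau K :=
  (hoefsmitRep hα hβ0 hβ l).comp (commutator (ArtinB n)).subtype

end Hoefsmit

namespace MatrixRep

variable {G K ι κ : Type*} [Group G] [Field K] [Fintype ι] [DecidableEq ι] [Fintype κ]
  [DecidableEq κ]

/-- Isomorphism of matrix representations. -/
def Iso (ρ : G →* GL ι K) (σ : G →* GL κ K) : Prop :=
  ∃ (P : Matrix ι κ K) (Q : Matrix κ ι K), P * Q = 1 ∧ Q * P = 1 ∧
    ∀ g : G, (ρ g : Matrix ι ι K) * P = P * (σ g : Matrix κ κ K)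

/-- The dual (contragredient) representation `g ↦ ᵗρ(g)⁻¹`. -/
def dual (ρ : G →* GL ι K) : G →* GL ι K where
  toFun g :=
    { val := (ρ g⁻¹ : Matrix ι ι K)ᵀ
      inv := (ρ g : Matrix ι ι K)ᵀ
      val_inv := by
        rw [← Matrix.transpose_mul, ← Units.val_mul, ← map_mul, mul_inv_cancel, map_one,
          Units.val_one, Matrix.transpose_one]
      inv_val := by
        rw [← Matrix.transpose_mul, ← Units.val_mul, ← map_mul, inv_mul_cancel, map_one,
          Units.val_one, Matrix.transpose_one] }
  map_one' := by
    apply Units.ext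
    simp
  map_mul' g h := by
    apply Units.ext
    simp only [Units.val_mul, _root_.mul_inv_rev, map_mul, Matrix.transpose_mul]

/-- `ε ∘ ρ`: apply the field automorphism `ε` to all the matrix entries. -/
def twist (ε : K ≃+* K) (ρ : G →* GL ι K) : G →* GL ι K :=
  (Matrix.GeneralLinearGroup.map (ε : K →+* K)).comp ρ

end MatrixRep

open scoped commutatorElement

/-! ### Intertwiners of matrix representations -/

namespace MatrixRep

variable {G K ι κ τ : Type*} [Group G] [Field K] [Fintype ι] [DecidableEq ι] [Fintype κ]
  [DecidableEq κ] [Fintype τ] [DecidableEq τ]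

/-! The proof has two halves: the restriction of `R_l` to the derived subgroup remembers the shape
`l`, and every dual or twisted representation in the statement is, on the derived subgroup, some
`R_l` of an explicit shape.

Rigidity. Over an algebraic closure, let `P` be an isomorphism between the restrictions of `R_m` and
`R_l`. The whole Artin group acts on matrices by `M ↦ R_l(g) M R_m(g)⁻¹`, and `P` is fixed by the
derived subgroup. The fixed space is a nonzero representation of the abelianization, so it has a
joint eigenvector: a nonzero `P'` intertwining up to a character `χ` (`exists_semi_intertwiner`).
Jucys-Murphy elements act diagonally by contents (`exists_jucysMurphy`), hence a nonzero entry of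
`P'` at `(T, U)` forces the contents of `T` and `U` to be proportional, with factors independent of
`T` and `U`. Contents determine standard tableaux, even across shapes (`boxPos_eq_of_content_eq`),
so the support of `P'` is a partial matching, and it is stable under admissible exchanges
(`exists_match_exchange`). As both components of `l` are non-empty, some matched `T` has its first
two entries in different components; comparing diagonal entries of `T` and `S_1` there gives the
value `1` for `χ` on both, and braid relations carry it to all generators (`character_eq_one`). Then
matched tableaux have equal contents, so `l = m`.

Isomorphisms. A matrix intertwining generators up to scalars intertwines the derived subgroup
exactly, because the scalars cancel in commutators (`iso_commutator_of_generators`). Transposing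
diagrams inverts the powers of `α`, and swapping the components exchanges the factors `β` and `-1`.
Thus the relabelling of boxes proper to each case multiplies the contents by a constant, or inverts
them up to one, once `ε` has acted on `α` and `β`. A monomial matrix then intertwines up to scalars.
Its weights are `1` when `ε` fixes `α`, signs of permutations for the dual, and the products
`tableauWeight` when `ε` inverts `α`.

Field theory. When `α + α⁻¹` and `β + β⁻¹` generate a proper subfield, Galois theory gives a
nontrivial `ε` fixing it. It sends each of `α`, `β` to itself or its inverse, and the hypotheses of
each case decide which. Cyclicity of the Galois group makes `ε` the only automorphism of order two.
-/

theorem Iso.refl (ρ : G →* GL ι K) : Iso ρ ρ :=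
  ⟨1, 1, by simp, by simp, by simp⟩

theorem Iso.symm {ρ : G →* GL ι K} {σ : G →* GL κ K} (h : Iso ρ σ) : Iso σ ρ := by
  obtain ⟨P, Q, hPQ, hQP, h⟩ := h
  refine ⟨Q, P, hQP, hPQ, fun g => ?_⟩
  calc (σ g : Matrix κ κ K) * Q = Q * (P * (σ g : Matrix κ κ K)) * Q := by
        rw [← Matrix.mul_assoc, hQP, Matrix.one_mul]
    _ = Q * (ρ g : Matrix ι ι K) := by
        rw [← h, ← Matrix.mul_assoc, Matrix.mul_assoc, hPQ, Matrix.mul_one]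

theorem Iso.trans {ρ : G →* GL ι K} {σ : G →* GL κ K} {θ : G →* GL τ K} (h₁ : Iso ρ σ)
    (h₂ : Iso σ θ) : Iso ρ θ := by
  obtain ⟨P, Q, hPQ, hQP, h⟩ := h₁
  obtain ⟨P', Q', hPQ', hQP', h'⟩ := h₂
  refine ⟨P * P', Q' * Q, ?_, ?_, fun g => ?_⟩
  · rw [Matrix.mul_assoc, ← Matrix.mul_assoc P', hPQ', Matrix.one_mul, hPQ]
  · rw [Matrix.mul_assoc, ← Matrix.mul_assoc Q, hQP, Matrix.one_mul, hQP']
  · rw [← Matrix.mul_assoc, h, Matrix.mul_assoc, h', Matrix.mul_assoc]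

theorem Iso.congr_right {ρ : G →* GL ι K} {σ : G →* GL κ K} {θ : G →* GL τ K} (h : Iso σ θ) :
    Iso ρ σ ↔ Iso ρ θ :=
  ⟨fun h' => h'.trans h, fun h' => h'.trans h.symm⟩

theorem Iso.twist {ρ : G →* GL ι K} {σ : G →* GL κ K} (ε : K ≃+* K) (h : Iso ρ σ) :
    Iso (MatrixRep.twist ε ρ) (MatrixRep.twist ε σ) := by
  obtain ⟨P, Q, hPQ, hQP, h⟩ := h
  refine ⟨P.map (ε : K →+* K), Q.map (ε : K →+* K), ?_, ?_, fun g => ?_⟩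
  · rw [← Matrix.map_mul, hPQ, Matrix.map_one _ (map_zero _) (map_one _)]
  · rw [← Matrix.map_mul, hQP, Matrix.map_one _ (map_zero _) (map_one _)]
  · have := congrArg (fun M => M.map (ε : K →+* K)) (h g)
    simp only [Matrix.map_mul] at this
    exact this

/-- If two representations of a group generated by `s` are intertwined up to scalars on `s`, then
their restrictions to the derived subgroup are isomorphic. -/
theorem iso_commutator_of_generators {ρ : G →* GL ι K} {σ : G →* GL κ K} {s : Set G}
    (hs : Subgroup.closure s = ⊤) {P : Matrix ι κ K} {Q : Matrix κ ι K} (hPQ : P * Q = 1)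
    (hQP : Q * P = 1)
    (h : ∀ g ∈ s, ∃ c : Kˣ, (ρ g : Matrix ι ι K) * P = (c : K) • (P * (σ g : Matrix κ κ K))) :
    Iso (ρ.comp (commutator G).subtype) (σ.comp (commutator G).subtype) := by
  have hinv : ∀ (g : G) (c : Kˣ),
      (ρ g : Matrix ι ι K) * P = (c : K) • (P * (σ g : Matrix κ κ K)) →
      (ρ g⁻¹ : Matrix ι ι K) * P = ((c⁻¹ : Kˣ) : K) • (P * (σ g⁻¹ : Matrix κ κ K)) := by
    intro g c hc
    have e1 : (ρ g⁻¹ : Matrix ι ι K) * (ρ g : Matrix ι ι K) = 1 := by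
      rw [← Units.val_mul, ← map_mul, inv_mul_cancel, map_one, Units.val_one]
    have e2 : (σ g : Matrix κ κ K) * (σ g⁻¹ : Matrix κ κ K) = 1 := by
      rw [← Units.val_mul, ← map_mul, mul_inv_cancel, map_one, Units.val_one]
    have e3 : P * (σ g⁻¹ : Matrix κ κ K) = (c : K) • ((ρ g⁻¹ : Matrix ι ι K) * P) := by
      calc P * (σ g⁻¹ : Matrix κ κ K)
          = (ρ g⁻¹ : Matrix ι ι K) * ((ρ g : Matrix ι ι K) * P) * (σ g⁻¹ : Matrix κ κ K) := by
            rw [← Matrix.mul_assoc, e1, Matrix.one_mul]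
        _ = (c : K) • ((ρ g⁻¹ : Matrix ι ι K) * P) := by
            rw [hc, Matrix.mul_smul, Matrix.smul_mul, Matrix.mul_assoc, Matrix.mul_assoc, e2,
              Matrix.mul_one]
    rw [e3, smul_smul, Units.inv_mul, one_smul]
  have hmul : ∀ (g g' : G) (c c' : Kˣ),
      (ρ g : Matrix ι ι K) * P = (c : K) • (P * (σ g : Matrix κ κ K)) →
      (ρ g' : Matrix ι ι K) * P = (c' : K) • (P * (σ g' : Matrix κ κ K)) →
      (ρ (g * g') : Matrix ι ι K) * P =
        ((c * c' : Kˣ) : K) • (P * (σ (g * g') : Matrix κ κ K)) := by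
    intro g g' c c' hc hc'
    rw [map_mul, map_mul, Units.val_mul, Units.val_mul, Matrix.mul_assoc, hc', Matrix.mul_smul,
      ← Matrix.mul_assoc, hc, Matrix.smul_mul, smul_smul, Matrix.mul_assoc, Units.val_mul, mul_comm]
  -- The elements intertwined up to a scalar form a subgroup, here the whole group.
  have hall : ∀ g : G, ∃ c : Kˣ,
      (ρ g : Matrix ι ι K) * P = (c : K) • (P * (σ g : Matrix κ κ K)) := by
    intro g
    have hg : g ∈ Subgroup.closure s := hs ▸ Subgroup.mem_top g
    induction hg using Subgroup.closure_induction with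
    | mem x hx => exact h x hx
    | one => exact ⟨1, by simp⟩
    | mul x y _ _ hx hy =>
      obtain ⟨c, hc⟩ := hx
      obtain ⟨c', hc'⟩ := hy
      exact ⟨_, hmul _ _ _ _ hc hc'⟩
    | inv x _ hx =>
      obtain ⟨c, hc⟩ := hx
      exact ⟨_, hinv _ _ hc⟩
  -- The elements intertwined with scalar `1`. A commutator lies there because its scalar is `c c'
  -- c⁻¹ c'⁻¹ = 1`.
  let H : Subgroup G :=
    { carrier := {g | (ρ g : Matrix ι ι K) * P = P * (σ g : Matrix κ κ K)}
      one_mem' := by simp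
      mul_mem' := fun {a b} ha hb => by
        simpa using hmul a b 1 1 (by simpa using ha) (by simpa using hb)
      inv_mem' := fun {a} ha => by simpa using hinv a 1 (by simpa using ha) }
  have hH : commutator G ≤ H := by
    rw [commutator_def, Subgroup.commutator_le]
    intro g _ g' _
    obtain ⟨c, hc⟩ := hall g
    obtain ⟨c', hc'⟩ := hall g'
    have := hmul _ _ _ _ (hmul _ _ _ _ (hmul _ _ _ _ hc hc') (hinv _ _ hc)) (hinv _ _ hc')
    rw [show c * c' * c⁻¹ * c'⁻¹ = 1 by rw [mul_comm c c', mul_inv_cancel_right, mul_inv_cancel],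
      Units.val_one, one_smul] at this
    exact this
  exact ⟨P, Q, hPQ, hQP, fun g => hH g.2⟩

end MatrixRep

/-! ### Joint eigenvectors -/

/-- If a representation of `G` on a finite dimensional space over an algebraically closed field has
a nonzero vector fixed by the derived subgroup, then it has a joint eigenvector. -/
theorem exists_joint_eigenvector {G F M : Type*} [Group G] [Field F] [IsAlgClosed F]
    [AddCommGroup M] [Module F M] [FiniteDimensional F M] (Φ : G →* Module.End F M) {x : M}
    (hx : x ≠ 0) (hfix : ∀ g ∈ commutator G, Φ g x = x) :
    ∃ y : M, y ≠ 0 ∧ ∃ χ : G →* F, ∀ g, Φ g y = χ g • y := by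
  -- Nonzero invariant subspaces on which the derived subgroup acts trivially. On such a subspace
  -- all operators commute; in a minimal one each of them must be a scalar.
  let good : Set (Submodule F M) := {W | W ≠ ⊥ ∧ (∀ g, ∀ w ∈ W, Φ g w ∈ W) ∧
    ∀ g ∈ commutator G, ∀ w ∈ W, Φ g w = w}
  let V : Submodule F M :=
    { carrier := {w | ∀ g ∈ commutator G, Φ g w = w}
      zero_mem' := fun g _ => map_zero _
      add_mem' := fun {a b} ha hb g hg => by rw [map_add, ha g hg, hb g hg]
      smul_mem' := fun c a ha g hg => by rw [map_smul, ha g hg] }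
  have hV : V ∈ good := by
    refine ⟨fun h => hx ((Submodule.mem_bot F).1 (h ▸ (show x ∈ V from hfix))), ?_,
      fun g hg w hw => hw g hg⟩
    intro g w hw c hc
    have hc' : g⁻¹ * c * g ∈ commutator G := by
      simpa using (inferInstance : (commutator G).Normal).conj_mem c hc g⁻¹
    have := hw _ hc'
    -- Normality of the derived subgroup makes its fixed space invariant.
    have e : c * g = g * (g⁻¹ * c * g) := by group
    rw [← Module.End.mul_apply, ← map_mul, e, map_mul, Module.End.mul_apply, this]
  obtain ⟨W, ⟨hW0, hWinv, hWfix⟩, hmin⟩ :=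
    WellFounded.has_min (wellFounded_lt (α := Submodule F M)) good ⟨V, hV⟩
  obtain ⟨y, hyW, hy0⟩ := Submodule.exists_mem_ne_zero_of_ne_bot hW0
  have hscal : ∀ g, ∃ c : F, Φ g y = c • y := by
    intro g
    let f : Module.End F W := (Φ g).restrict (hWinv g)
    have : Nontrivial W := (Submodule.nontrivial_iff_ne_bot).2 hW0
    obtain ⟨c, hc⟩ := Module.End.exists_eigenvalue f
    obtain ⟨v, hv⟩ := hc.exists_hasEigenvector
    -- An eigenspace of one of the commuting operators is invariant, so minimality forces it to be
    -- all of `W`.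
    let W' : Submodule F M := W ⊓ Module.End.eigenspace (Φ g) c
    have hvW' : (v : M) ∈ W' :=
      ⟨v.2, Module.End.mem_eigenspace_iff.2 (by
        have := congrArg Subtype.val hv.apply_eq_smul
        simpa [f] using this)⟩
    have hW' : W' ∈ good := by
      refine ⟨fun h => hv.2 (Subtype.ext ((Submodule.mem_bot F).1 (h ▸ hvW'))), ?_,
        fun h hh w hw => hWfix h hh w hw.1⟩
      rintro h w ⟨hw1, hw2⟩
      refine ⟨hWinv h w hw1, Module.End.mem_eigenspace_iff.2 ?_⟩
      rw [SetLike.mem_coe, Module.End.mem_eigenspace_iff] at hw2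
      have e : g * h = h * g * ⁅g⁻¹, h⁻¹⁆ := by rw [commutatorElement_def]; group
      have hcom : ⁅g⁻¹, h⁻¹⁆ ∈ commutator G :=
        Subgroup.commutator_mem_commutator (Subgroup.mem_top _) (Subgroup.mem_top _)
      rw [← Module.End.mul_apply, ← map_mul, e, map_mul, Module.End.mul_apply, hWfix _ hcom w hw1,
        map_mul, Module.End.mul_apply, hw2, map_smul]
    have hle : W' = W := by
      by_contra hne
      exact hmin W' hW' (lt_of_le_of_ne inf_le_left hne)
    exact ⟨c, Module.End.mem_eigenspace_iff.1 ((hle ▸ hyW : y ∈ W')).2⟩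
  choose χ hχ using hscal
  refine ⟨y, hy0, ⟨⟨χ, ?_⟩, ?_⟩, hχ⟩
  · have := hχ 1
    rw [map_one, Module.End.one_apply] at this
    refine smul_left_injective F hy0 ?_
    simp only [one_smul]
    exact this.symm
  · intro g h
    refine smul_left_injective F hy0 ?_
    change χ (g * h) • y = (χ g * χ h) • y
    rw [← hχ, map_mul, Module.End.mul_apply, hχ h, map_smul, hχ g, smul_smul, mul_comm]

/-- Two matrix representations over an algebraically closed field with a nonzero intertwiner for the
derived subgroup have a nonzero intertwiner up to a character of the whole group. -/
theorem MatrixRep.exists_semi_intertwiner {G F ι κ : Type*} [Group G] [Field F] [IsAlgClosed F]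
    [Fintype ι] [DecidableEq ι] [Fintype κ] [DecidableEq κ] {ρ : G →* GL ι F} {σ : G →* GL κ F}
    {P : Matrix ι κ F} (hP : P ≠ 0)
    (h : ∀ g ∈ commutator G, (ρ g : Matrix ι ι F) * P = P * (σ g : Matrix κ κ F)) :
    ∃ P' : Matrix ι κ F, P' ≠ 0 ∧ ∃ χ : G →* F, ∀ g,
      (ρ g : Matrix ι ι F) * P' = χ g • (P' * (σ g : Matrix κ κ F)) := by
  have hσ : ∀ g, (σ g : Matrix κ κ F) * (σ g⁻¹ : Matrix κ κ F) = 1 := fun g => by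
    rw [← Units.val_mul, ← map_mul, mul_inv_cancel, map_one, Units.val_one]
  have hσ' : ∀ g, (σ g⁻¹ : Matrix κ κ F) * (σ g : Matrix κ κ F) = 1 := fun g => by
    rw [← Units.val_mul, ← map_mul, inv_mul_cancel, map_one, Units.val_one]
  -- The action on intertwining spaces `M ↦ ρ(g) M σ(g)⁻¹`. A vector fixed by the derived subgroup
  -- is an intertwiner for it, and a joint eigenvector is an intertwiner up to a character.
  let Φ : G →* Module.End F (Matrix ι κ F) :=
    { toFun := fun g =>
        { toFun := fun M => (ρ g : Matrix ι ι F) * M * (σ g⁻¹ : Matrix κ κ F)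
          map_add' := fun M N => by rw [Matrix.mul_add, Matrix.add_mul]
          map_smul' := fun c M => by rw [Matrix.mul_smul, Matrix.smul_mul, RingHom.id_apply] }
      map_one' := by
        ext1 M
        simp
      map_mul' := fun g g' => by
        apply LinearMap.ext
        intro M
        change (ρ (g * g') : Matrix ι ι F) * M * (σ (g * g')⁻¹ : Matrix κ κ F) =
          (ρ g : Matrix ι ι F) * ((ρ g' : Matrix ι ι F) * M * (σ g'⁻¹ : Matrix κ κ F)) *
            (σ g⁻¹ : Matrix κ κ F)
        simp only [mul_inv_rev, map_mul, Units.val_mul, Matrix.mul_assoc] }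
  obtain ⟨P', hP', χ, hχ⟩ := exists_joint_eigenvector Φ hP (fun g hg => by
    change (ρ g : Matrix ι ι F) * P * (σ g⁻¹ : Matrix κ κ F) = P
    rw [h g hg, Matrix.mul_assoc, hσ, Matrix.mul_one])
  refine ⟨P', hP', χ, fun g => ?_⟩
  have := congrArg (fun M => M * (σ g : Matrix κ κ F)) (hχ g)
  change (ρ g : Matrix ι ι F) * P' * (σ g⁻¹ : Matrix κ κ F) * (σ g : Matrix κ κ F) =
    (χ g • P') * (σ g : Matrix κ κ F) at this
  rwa [Matrix.mul_assoc _ _ (σ g : Matrix κ κ F), hσ', Matrix.mul_one, Matrix.smul_mul] at this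

/-! ### The automorphism of order two -/

section Involution

variable {p : ℕ} [Fact p.Prime] {K : Type*} [Field K] [Algebra (ZMod p) K]

/-- A finite field has at most one automorphism of order two. -/
theorem ringEquiv_eq_of_orderOf_eq_two {K : Type*} [Field K] [Finite K] (p : ℕ) [Fact p.Prime]
    [Algebra (ZMod p) K] {σ ε : K ≃+* K} (hσ : orderOf σ = 2) (hε : orderOf ε = 2) :
    σ = ε := by
  classical
  -- Field automorphisms fix the prime field, so they live in a Galois group, which is cyclic for
  -- finite fields.
  have lift : ∀ τ : K ≃+* K, orderOf τ = 2 → ∃ τ' : K ≃ₐ[ZMod p] K,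
      (∀ x, τ' x = τ x) ∧ τ' ^ 2 = 1 ∧ τ' ≠ 1 := by
    intro τ hτ
    refine ⟨AlgEquiv.ofRingEquiv (f := τ) fun r =>
      RingHom.congr_fun (Subsingleton.elim ((τ : K →+* K).comp (algebraMap (ZMod p) K))
        (algebraMap (ZMod p) K)) r, fun x => rfl, ?_, ?_⟩
    · ext x
      have := RingEquiv.congr_fun (hτ ▸ pow_orderOf_eq_one τ : τ ^ 2 = 1) x
      rw [pow_two] at this ⊢
      exact this
    · intro h
      have : τ = 1 := RingEquiv.ext fun x => AlgEquiv.congr_fun h x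
      rw [this, orderOf_one] at hτ
      omega
  obtain ⟨σ', h1, h2, h3⟩ := lift σ hσ
  obtain ⟨ε', k1, k2, k3⟩ := lift ε hε
  have heq : σ' = ε' := by
    by_contra hne
    have : Fintype (K ≃ₐ[ZMod p] K) := Fintype.ofFinite _
    -- A cyclic group has at most two solutions of `a ^ 2 = 1`, while `1`, `σ'`, `ε'` would be
    -- three.
    have hcard := IsCyclic.card_pow_eq_one_le (α := K ≃ₐ[ZMod p] K) (n := 2) (by norm_num)
    have hsub : ({1, σ', ε'} : Finset (K ≃ₐ[ZMod p] K)) ⊆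
        Finset.univ.filter (fun a => a ^ 2 = 1) := by
      intro a ha
      simp only [Finset.mem_insert, Finset.mem_singleton] at ha
      rcases ha with rfl | rfl | rfl <;> simp [h2, k2]
    have h3' : ({1, σ', ε'} : Finset (K ≃ₐ[ZMod p] K)).card = 3 :=
      Finset.card_eq_three.2 ⟨1, σ', ε', h3.symm, k3.symm, hne, rfl⟩
    have := Finset.card_le_card hsub
    omega
  ext x
  rw [← h1, ← k1, heq]

/-- `x` and `x⁻¹` are the two roots of `X² - (x + x⁻¹) X + 1`. This is how an automorphism fixing `x
+ x⁻¹` is known on `x`. -/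
theorem eq_or_eq_inv_of_add_inv_eq {x y : K} (hx : x ≠ 0) (hy : y ≠ 0)
    (h : y + y⁻¹ = x + x⁻¹) : y = x ∨ y = x⁻¹ := by
  have : (y - x) * (y * x - 1) = 0 := by
    field_simp at h
    linear_combination h
  rcases mul_eq_zero.1 this with h | h
  · exact Or.inl (sub_eq_zero.1 h)
  · exact Or.inr (eq_inv_of_mul_eq_one_left (sub_eq_zero.1 h))

theorem algEquiv_eq_one_of_adjoin_eq_top {S : Set K}
    (hS : IntermediateField.adjoin (ZMod p) S = ⊤) {σ : K ≃ₐ[ZMod p] K} (h : ∀ x ∈ S, σ x = x) :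
    σ = 1 := by
  have hle : IntermediateField.adjoin (ZMod p) S ≤
      IntermediateField.fixedField (Subgroup.zpowers σ) := by
    rw [IntermediateField.adjoin_le_iff]
    rintro x hx ⟨τ, k, rfl⟩
    have hx' : σ ∈ MulAction.stabilizer (K ≃ₐ[ZMod p] K) x := h x hx
    exact zpow_mem hx' k
  ext x
  have hx : x ∈ IntermediateField.fixedField (Subgroup.zpowers σ) :=
    hle (hS ▸ IntermediateField.mem_top)
  exact hx ⟨σ, Subgroup.mem_zpowers σ⟩

/-- For a proper subfield `𝔽_p(α + α⁻¹, β + β⁻¹)`, some nontrivial automorphism fixes it, and it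
sends `α` and `β` to themselves or to their inverses. -/
theorem exists_algEquiv_ne_one [Finite K] {α β : K} (hα : α ≠ 0) (hβ : β ≠ 0)
    (hL : IntermediateField.adjoin (ZMod p) {α + α⁻¹, β + β⁻¹} ≠ ⊤) :
    ∃ ε : K ≃ₐ[ZMod p] K, ε ≠ 1 ∧
      (∀ x ∈ IntermediateField.adjoin (ZMod p) {α + α⁻¹, β + β⁻¹}, ε x = x) ∧
      (ε α = α ∨ ε α = α⁻¹) ∧ (ε β = β ∨ ε β = β⁻¹) := by
  set L := IntermediateField.adjoin (ZMod p) {α + α⁻¹, β + β⁻¹} with hLdef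
  -- By the Galois correspondence, a trivial fixing subgroup would make `L` the whole field.
  obtain ⟨ε, hεL, hε⟩ : ∃ ε ∈ L.fixingSubgroup, ε ≠ 1 := by
    by_contra! hcon
    apply hL
    have : L.fixingSubgroup = ⊥ := (Subgroup.eq_bot_iff_forall _).2 hcon
    rw [← IsGalois.fixedField_fixingSubgroup L, this, IntermediateField.fixedField_bot]
  have hfix : ∀ x ∈ L, ε x = x := fun x hx =>
    (IntermediateField.mem_fixingSubgroup_iff L ε).1 hεL x hx
  refine ⟨ε, hε, hfix, ?_, ?_⟩
  · refine eq_or_eq_inv_of_add_inv_eq hα (by simpa using hα) ?_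
    rw [← map_inv₀, ← map_add]
    exact hfix _ (IntermediateField.subset_adjoin _ _ (by simp))
  · refine eq_or_eq_inv_of_add_inv_eq hβ (by simpa using hβ) ?_
    rw [← map_inv₀, ← map_add]
    exact hfix _ (IntermediateField.subset_adjoin _ _ (by simp))

/-- A nontrivial automorphism that sends each of `α` and `β` to itself or to its inverse is the
unique automorphism of order two of `𝔽_p(α, β)`. -/
theorem orderOf_eq_two_iff_eq [Finite K] {α β : K}
    (hK : IntermediateField.adjoin (ZMod p) {α, β} = ⊤)
    {ε : K ≃ₐ[ZMod p] K} (hε : ε ≠ 1) (hα : ε α = α ∨ ε α = α⁻¹) (hβ : ε β = β ∨ ε β = β⁻¹)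
    (σ : K ≃+* K) : orderOf σ = 2 ↔ σ = (ε : K ≃+* K) := by
  have hsq : ε * ε = 1 := by
    apply algEquiv_eq_one_of_adjoin_eq_top hK
    rintro x (rfl | rfl)
    · rcases hα with h | h <;> simp [h]
    · rcases hβ with h | h <;> simp [h]
  have hord : orderOf (ε : K ≃+* K) = 2 := by
    apply orderOf_eq_prime
    · ext x
      rw [pow_two]
      exact AlgEquiv.congr_fun hsq x
    · intro h
      exact hε (AlgEquiv.ext fun x => RingEquiv.congr_fun h x)
  exact ⟨fun h => ringEquiv_eq_of_orderOf_eq_two p h hord, fun h => h ▸ hord⟩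

end Involution

/-! ### Contents of boxes -/

namespace HoefsmitAux

open DoublePartition

variable {n : ℕ} {K : Type*} [Field K] {α β : K} {l m : DoublePartition n}

theorem zpow_eq_one_imp (h0 : α ≠ 0) {s : ℤ} (h : α ^ s = 1) (hs : |s| < orderOf α) : s = 0 := by
  have e : (Units.mk0 α h0) ^ s = 1 := by
    ext; simpa using h
  have h4 := orderOf_dvd_iff_zpow_eq_one.2 e
  rw [← orderOf_units, Units.val_mk0] at h4
  exact Int.eq_zero_of_abs_lt_dvd h4 hs

theorem fin_two_cases (x : Fin 2) : x = 0 ∨ x = 1 := by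
  revert x; decide

/-- The component, row and column of a box. -/
def boxPos (b : l.Box) : Fin 2 × ℕ × ℕ := (b.1, b.2.1)

theorem boxPos_injective : Function.Injective (boxPos (l := l)) := by
  rintro ⟨k, a, ha⟩ ⟨k', b, hb⟩ h
  simp only [boxPos, Prod.mk.injEq] at h
  obtain ⟨rfl, rfl⟩ := h
  rfl

theorem card_comp_le (l : DoublePartition n) (k : Fin 2) : (l.comp k).card ≤ n := by
  have := card_comp l
  rcases fin_two_cases k with rfl | rfl <;> omega

theorem card_comp_add (l : DoublePartition n) {k k' : Fin 2} (h : k ≠ k') :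
    (l.comp k).card + (l.comp k').card = n := by
  have := card_comp l
  rcases fin_two_cases k with rfl | rfl <;> rcases fin_two_cases k' with rfl | rfl <;>
    first | exact absurd rfl h | omega

theorem arm_lt (μ : YoungDiagram) {r c : ℕ} (h : (r, c) ∈ μ.cells) :
    c + 1 ≤ μ.card ∧ r + 1 ≤ μ.card := by
  have h1 := hook_le μ (c := c) (r := 0) (μ.up_left_mem (Nat.zero_le _) le_rfl h)
    (μ.up_left_mem (Nat.zero_le _) (Nat.zero_le _) h)
  have h2 := hook_le μ (c := 0) (r := r) (μ.up_left_mem (Nat.zero_le _) (Nat.zero_le _) h)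
    (μ.up_left_mem le_rfl (Nat.zero_le _) h)
  omega

/-- Contents of incomparable boxes do not have ratio `α`. -/
theorem mul_ct_ne (hα : n < orderOf α) (hβ0 : β ≠ 0) (hβ : ∀ i : ℤ, |i| ≤ (n : ℤ) - 1 → β ≠ -α ^ i)
    {A B : l.Box} (h1 : ¬ A < B) (h2 : ¬ B < A) :
    α * boxContent α β A ≠ boxContent α β B := by
  have h0 := ne_zero_of hα
  obtain ⟨k, a⟩ := A
  obtain ⟨k', b⟩ := B
  intro h
  by_cases hk : k = k'
  · subst hk
    have e : α ^ ((a.1.2 : ℤ) - a.1.1 + 1) = α ^ ((b.1.2 : ℤ) - b.1.1) := by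
      rw [zpow_add_one₀ h0]
      simp only [boxContent, Box.row, Box.col] at h
      split_ifs at h
      · exact mul_left_cancel₀ hβ0 (by linear_combination h)
      · linear_combination -h
    have b1 := bound_same a b
    have b2 := bound_same b a
    have e' : α ^ (((a.1.2 : ℤ) - a.1.1 + 1) - ((b.1.2 : ℤ) - b.1.1)) = 1 := by
      rw [zpow_sub₀ h0, e, div_self (zpow_ne_zero _ h0)]
    -- The exponent has absolute value at most `n`, below the order of `α`, so `B` lies on the
    -- diagonal just above that of `A`. Two boxes on adjacent diagonals are always comparable.
    have := zpow_eq_one_imp h0 e' (by rw [abs_lt]; constructor <;> omega)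
    rw [lt_iff] at h1 h2
    have hne : a.1 ≠ b.1 := fun hab => by rw [hab] at this; omega
    by_cases hr : a.1.1 ≤ b.1.1
    · exact h1 ⟨hr, by omega, hne⟩
    · exact h2 ⟨by omega, by omega, hne.symm⟩
  · rcases fin_two_cases k with rfl | rfl <;> rcases fin_two_cases k' with rfl | rfl
    · exact hk rfl
    -- Across components the exponents differ by at most `n - 2`, so the shift by one coming from
    -- the factor `α` stays within the range excluded for `β`.
    · have hb := bound_diff a b
      simp only [boxContent, Box.row, Box.col, if_true, one_ne_zero, if_false] at h
      refine hβ (((b.1.2 : ℤ) - b.1.1) - ((a.1.2 : ℤ) - a.1.1) - 1) ?_ ?_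
      · rw [abs_le]
        have := abs_le.1 (show |((a.1.2 : ℤ) - a.1.1) - ((b.1.2 : ℤ) - b.1.1)| ≤ n - 2
          by omega)
        omega
      · rw [zpow_sub_one₀ h0, zpow_sub₀ h0]
        have := zpow_ne_zero ((a.1.2 : ℤ) - a.1.1) h0
        field_simp
        linear_combination h
    · have hb := bound_diff b a
      simp only [boxContent, Box.row, Box.col, if_true, one_ne_zero, if_false] at h
      refine hβ (((a.1.2 : ℤ) - a.1.1) - ((b.1.2 : ℤ) - b.1.1) + 1) ?_ ?_
      · rw [abs_le]
        have := abs_le.1 (show |((b.1.2 : ℤ) - b.1.1) - ((a.1.2 : ℤ) - a.1.1)| ≤ n - 2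
          by omega)
        omega
      · rw [zpow_add_one₀ h0, zpow_sub₀ h0]
        have := zpow_ne_zero ((b.1.2 : ℤ) - b.1.1) h0
        field_simp
        linear_combination -h
    · exact hk rfl

/-- Exchanging consecutive entries changes the relative order of no other pair of boxes, so only a
comparison between the two boxes involved can be violated. -/
theorem strictMono_exchange_iff {f : l.Filling} (hf : StrictMono f) {i j : Fin n}
    (hij : j.1 = i.1 + 1) :
    StrictMono (f.exchange i j) ↔ ¬ f.symm i < f.symm j := by
  constructor
  · intro h hlt
    have := h hlt
    simp only [exchange_apply, Equiv.apply_symm_apply, Equiv.swap_apply_left,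
      Equiv.swap_apply_right, Fin.lt_def] at this
    omega
  · intro h
    by_contra hcon
    obtain ⟨A, B, hAB, rfl, rfl⟩ := not_std hf hij hcon
    simp only [Equiv.symm_apply_apply] at h
    exact h hAB

theorem not_lt_of_le {f : l.Filling} (hf : StrictMono f) {i j : Fin n} (hij : i ≤ j) :
    ¬ f.symm j < f.symm i := by
  intro h
  have := hf h
  simp only [Equiv.apply_symm_apply] at this
  exact absurd this (not_lt.2 hij)

theorem not_lt_of_fst_ne {A B : l.Box} (h : A.1 ≠ B.1) : ¬ A < B := fun hAB =>
  h (Sigma.lt_def.1 hAB).1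

/-! ### A standard double-tableau is determined by its contents -/

theorem content_fst_ne_zero {b : l.Box} (h : b.1 = 1) :
    boxContent α β b = -α ^ ((b.col : ℤ) - (b.row : ℤ)) := by
  rw [boxContent, if_neg (by rw [h]; exact one_ne_zero)]

/-- A box weakly up-left of the box with entry `k` of a tableau `U`, if not that box itself, is a box
of every tableau `T` which agrees with `U` on the entries below `k`. -/
theorem mem_comp_of_agree {f : l.Filling} {g : m.Filling} (hg : StrictMono g) {k : Fin n}
    (ih : ∀ j < k, boxPos (f.symm j) = boxPos (g.symm j)) {r c : ℕ}
    (hr : r ≤ (g.symm k).row) (hc : c ≤ (g.symm k).col)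
    (hne : r < (g.symm k).row ∨ c < (g.symm k).col) :
    ∃ j < k, boxPos (f.symm j) = ((g.symm k).1, r, c) ∧ (r, c) ∈ (l.comp (g.symm k).1).cells := by
  obtain ⟨q, a, ha⟩ : ∃ q a, g.symm k = ⟨q, a⟩ := ⟨_, _, rfl⟩
  have eg : g ⟨q, a⟩ = k := by rw [← ha, Equiv.apply_symm_apply]
  rw [ha] at hr hc hne ⊢
  simp only [Box.row, Box.col] at hr hc hne ⊢
  have hx := mem_of_le a hr hc
  have hlt : g ⟨q, (r, c), hx⟩ < k := by
    rw [← eg]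
    exact hg (lt_iff.2 ⟨hr, hc, fun h => by
      have h1 := congrArg Prod.fst h
      have h2 := congrArg Prod.snd h
      simp only at h1 h2
      omega⟩)
  have hpos := ih _ hlt
  rw [Equiv.symm_apply_apply] at hpos
  refine ⟨_, hlt, hpos, ?_⟩
  obtain ⟨q', a', ha'⟩ : ∃ s a, f.symm (g ⟨q, (r, c), hx⟩) = ⟨s, a⟩ := ⟨_, _, rfl⟩
  rw [ha'] at hpos
  simp only [boxPos, Prod.mk.injEq] at hpos
  obtain ⟨rfl, hpos⟩ := hpos
  rw [← hpos]
  exact a'.2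

theorem row_col_mem (b : l.Box) : (b.row, b.col) ∈ (l.comp b.1).cells := b.2.2

/-- Bound for the contents of two boxes that can be added to the same double-partition. -/
theorem content_sub_le {f : l.Filling} {g : m.Filling} (hg : StrictMono g) {k : Fin n}
    (ih : ∀ j < k, boxPos (f.symm j) = boxPos (g.symm j)) (h : (f.symm k).1 = (g.symm k).1) :
    (f.symm k).col + (g.symm k).row ≤ n ∧ (f.symm k).row + (g.symm k).col ≤ n := by
  have hmem := row_col_mem (f.symm k)
  have hcard := card_comp_le l (f.symm k).1
  constructor
  · rcases Nat.eq_zero_or_pos (g.symm k).row with h0 | hpos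
    · have := arm_lt _ hmem
      omega
    -- The box of `g` need not belong to `l`, but the first box of the row above it does; the hook
    -- bound in `l` then loses one, which gives `n` instead of `n - 1`.
    · obtain ⟨_, _, _, hx⟩ := mem_comp_of_agree hg ih (r := (g.symm k).row - 1) (c := 0)
        (by omega) (by omega) (by omega)
      rw [← h] at hx
      have := hook_le _ ((l.comp _).up_left_mem (Nat.zero_le _) le_rfl hmem) hx
      omega
  · rcases Nat.eq_zero_or_pos (g.symm k).col with h0 | hpos
    · have := arm_lt _ hmem
      omega
    · obtain ⟨_, _, _, hx⟩ := mem_comp_of_agree hg ih (r := 0) (c := (g.symm k).col - 1)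
        (by omega) (by omega) (by omega)
      rw [← h] at hx
      have := hook_le _ hx ((l.comp _).up_left_mem le_rfl (Nat.zero_le _) hmem)
      omega

/-- Otherwise `β = -α ^ i`. The box of `f` lies in the left diagram of `l`, and that of `g` is at
most one step beyond the right diagram of `l`; the two sizes add up to `n`, so `|i| ≤ n - 1`, which
is excluded. -/
theorem fst_eq_of_content_eq (h0 : α ≠ 0) (hβ : ∀ i : ℤ, |i| ≤ (n : ℤ) - 1 → β ≠ -α ^ i)
    {f : l.Filling} {g : m.Filling} (hg : StrictMono g) {k : Fin n}
    (ih : ∀ j < k, boxPos (f.symm j) = boxPos (g.symm j))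
    (h : boxContent α β (f.symm k) = boxContent α β (g.symm k))
    (hf0 : (f.symm k).1 = 0) : (g.symm k).1 = 0 := by
  by_contra hg0
  have hg1 : (g.symm k).1 = 1 := (fin_two_cases _).resolve_left hg0
  have hmem := arm_lt _ (row_col_mem (f.symm k))
  have hne : (f.symm k).1 ≠ (g.symm k).1 := by rw [hf0, hg1]; exact zero_ne_one
  have hcard := card_comp_add l hne
  have b1 : (g.symm k).row ≤ (l.comp (g.symm k).1).card := by
    rcases Nat.eq_zero_or_pos (g.symm k).row with h0 | hpos
    · omega
    · obtain ⟨_, _, _, hx⟩ := mem_comp_of_agree hg ih (r := (g.symm k).row - 1) (c := 0)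
        (by omega) (by omega) (by omega)
      have := arm_lt _ hx
      omega
  have b2 : (g.symm k).col ≤ (l.comp (g.symm k).1).card := by
    rcases Nat.eq_zero_or_pos (g.symm k).col with h0 | hpos
    · omega
    · obtain ⟨_, _, _, hx⟩ := mem_comp_of_agree hg ih (r := 0) (c := (g.symm k).col - 1)
        (by omega) (by omega) (by omega)
      have := arm_lt _ hx
      omega
  rw [content_fst_ne_zero hg1, boxContent, if_pos hf0] at h
  refine hβ (((g.symm k).col - (g.symm k).row : ℤ) - ((f.symm k).col - (f.symm k).row)) ?_ ?_
  · rw [abs_le]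
    constructor <;> omega
  · rw [zpow_sub₀ h0, ← neg_div, ← h, mul_div_cancel_right₀ _ (zpow_ne_zero _ h0)]

/-- Strong induction on the entry. If all smaller entries agree, equal contents force the same
component, then the same diagonal since the exponents differ by at most `n`, less than the order of
`α`. Two different boxes on one diagonal are nested, and the inner one would already carry a smaller
entry. -/
theorem boxPos_eq_of_content_eq (hα : n < orderOf α) (hβ0 : β ≠ 0)
    (hβ : ∀ i : ℤ, |i| ≤ (n : ℤ) - 1 → β ≠ -α ^ i) {f : l.Filling} {g : m.Filling}
    (hf : StrictMono f) (hg : StrictMono g)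
    (h : ∀ k, boxContent α β (f.symm k) = boxContent α β (g.symm k)) (k : Fin n) :
    boxPos (f.symm k) = boxPos (g.symm k) := by
  have h0 := ne_zero_of hα
  induction k using WellFoundedLT.induction with
  | _ k ih =>
  have ih' : ∀ j < k, boxPos (g.symm j) = boxPos (f.symm j) := fun j hj => (ih j hj).symm
  have hfst : (f.symm k).1 = (g.symm k).1 := by
    rcases fin_two_cases (f.symm k).1 with e | e
    · rw [e, fst_eq_of_content_eq h0 hβ hg ih (h k) e]
    · rcases fin_two_cases (g.symm k).1 with e' | e'
      · rw [e', fst_eq_of_content_eq h0 hβ hf ih' (h k).symm e']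
      · rw [e, e']
  have hk := h k
  have e : α ^ (((f.symm k).col : ℤ) - (f.symm k).row) =
      α ^ (((g.symm k).col : ℤ) - (g.symm k).row) := by
    simp only [boxContent, hfst] at hk
    split_ifs at hk
    · exact mul_left_cancel₀ hβ0 hk
    · exact neg_injective hk
  have e' : α ^ ((((f.symm k).col : ℤ) - (f.symm k).row) -
      (((g.symm k).col : ℤ) - (g.symm k).row)) = 1 := by
    rw [zpow_sub₀ h0, e, div_self (zpow_ne_zero _ h0)]
  obtain ⟨b1, b2⟩ := content_sub_le hg ih hfst
  have hd := zpow_eq_one_imp h0 e' (by rw [abs_lt]; constructor <;> omega)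
  -- If the rows differ, the box nearer the corner carries some `j < k` in the other tableau, hence
  -- in both by induction; it would then carry `j` and `k` at once.
  have hrow : (f.symm k).row = (g.symm k).row := by
    rcases lt_trichotomy (f.symm k).row (g.symm k).row with hlt | heq | hgt
    · exfalso
      obtain ⟨j, hj, hpos, _⟩ := mem_comp_of_agree hg ih (r := (f.symm k).row)
        (c := (f.symm k).col) (by omega) (by omega) (by omega)
      rw [← hfst] at hpos
      have : boxPos (f.symm j) = boxPos (f.symm k) := hpos
      exact hj.ne (f.symm.injective (boxPos_injective this))
    · exact heq
    · exfalso
      obtain ⟨j, hj, hpos, _⟩ := mem_comp_of_agree hf ih' (r := (g.symm k).row)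
        (c := (g.symm k).col) (by omega) (by omega) (by omega)
      rw [hfst] at hpos
      have : boxPos (g.symm j) = boxPos (g.symm k) := hpos
      exact hj.ne (g.symm.injective (boxPos_injective this))
  have hcol : (f.symm k).col = (g.symm k).col := by omega
  exact Prod.ext hfst (Prod.ext hrow hcol)

theorem stdTableau_eq_of_content_eq (hα : n < orderOf α) (hβ0 : β ≠ 0)
    (hβ : ∀ i : ℤ, |i| ≤ (n : ℤ) - 1 → β ≠ -α ^ i) {T U : l.StdTableau}
    (h : ∀ k, boxContent α β (T.1.symm k) = boxContent α β (U.1.symm k)) : T = U := by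
  apply Subtype.ext
  have : T.1.symm = U.1.symm := Equiv.ext fun k =>
    boxPos_injective (boxPos_eq_of_content_eq hα hβ0 hβ T.2 U.2 h k)
  rw [← Equiv.symm_symm T.1, this, Equiv.symm_symm]

theorem comp_le_of_boxPos_eq {f : l.Filling} {g : m.Filling}
    (h : ∀ k, boxPos (f.symm k) = boxPos (g.symm k)) (q : Fin 2) : l.comp q ≤ m.comp q := by
  intro x hx
  have hk := h (f ⟨q, x, hx⟩)
  rw [Equiv.symm_apply_apply] at hk
  have hmem := row_col_mem (g.symm (f ⟨q, x, hx⟩))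
  simp only [boxPos, Prod.mk.injEq] at hk
  rw [← hk.1] at hmem
  change (g.symm (f ⟨q, x, hx⟩)).2.1 ∈ _ at hmem
  rwa [← hk.2] at hmem

theorem eq_of_content_eq (hα : n < orderOf α) (hβ0 : β ≠ 0)
    (hβ : ∀ i : ℤ, |i| ≤ (n : ℤ) - 1 → β ≠ -α ^ i) {f : l.Filling} {g : m.Filling}
    (hf : StrictMono f) (hg : StrictMono g)
    (h : ∀ k, boxContent α β (f.symm k) = boxContent α β (g.symm k)) : l = m := by
  have hpos := boxPos_eq_of_content_eq hα hβ0 hβ hf hg h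
  have hle := comp_le_of_boxPos_eq hpos
  have hge := comp_le_of_boxPos_eq fun k => (hpos k).symm
  exact DoublePartition.ext (le_antisymm (hle 0) (hge 0)) (le_antisymm (hle 1) (hge 1))

end HoefsmitAux

namespace HoefsmitAux

open DoublePartition

variable {n : ℕ} {K : Type*} [Field K] {α β : K} {l m : DoublePartition n}

/-! ### Entries of the generators -/

theorem exchange_ne (f : l.Filling) {i j : Fin n} (hij : i ≠ j) : f.exchange i j ≠ f := by
  intro h
  have := congrArg (fun g : l.Filling => g (f.symm i)) h
  simp only [exchange_apply, Equiv.apply_symm_apply, Equiv.swap_apply_left] at this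
  exact hij this.symm

theorem hoefsmitS_apply_self (T : l.StdTableau) {i j : Fin n} (hij : i ≠ j) :
    hoefsmitS α β l i j T T = hoefsmitCoeff α β T.1 i j := by
  simp [hoefsmitS, fillingVec, (exchange_ne T.1 hij).symm]

theorem hoefsmitS_apply_exchange {T T' : l.StdTableau} {i j : Fin n} (hij : i ≠ j)
    (h : T'.1 = T.1.exchange i j) :
    hoefsmitS α β l i j T' T = 1 + hoefsmitCoeff α β T.1 i j := by
  simp [hoefsmitS, fillingVec, h, exchange_ne T.1 hij]

theorem hoefsmitS_apply_of_ne {T T' : l.StdTableau} {i j : Fin n} (h1 : T' ≠ T)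
    (h2 : T'.1 ≠ T.1.exchange i j) : hoefsmitS α β l i j T' T = 0 := by
  have h1' : T'.1 ≠ T.1 := fun e => h1 (Subtype.ext e)
  simp [hoefsmitS, fillingVec, h1', h2]

theorem hoefsmitCoeff_exchange (f : l.Filling) (i j : Fin n) :
    hoefsmitCoeff α β (f.exchange i j) i j = hoefsmitCoeff α β f j i := by
  simp [hoefsmitCoeff, exchange_symm]

/-- The numerator `α ct(j) - ct(i)` decides when an off-diagonal entry vanishes, and it is also the
factor from which the tableau weights are built. -/
theorem one_add_hoefsmitCoeff (hα : n < orderOf α) (hβ0 : β ≠ 0)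
    (hβ : ∀ i : ℤ, |i| ≤ (n : ℤ) - 1 → β ≠ -α ^ i) {f : l.Filling} (hf : StrictMono f)
    {i j : Fin n} (hij : j.1 = i.1 + 1) :
    1 + hoefsmitCoeff α β f i j =
      (α * boxContent α β (f.symm j) - boxContent α β (f.symm i)) /
        (boxContent α β (f.symm j) - boxContent α β (f.symm i)) := by
  have h0 := ne_zero_of hα
  have hne := ct_ne hα h0 hβ0 hβ hf (i := i) (j := j) (by omega) (by omega)
  unfold hoefsmitCoeff
  rw [coeff_eq (ct_ne_zero h0 hβ0 _) hne]
  have := sub_ne_zero.2 hne.symm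
  field_simp
  ring

/-- Exchangeable entries sit in incomparable boxes, and `mul_ct_ne` keeps the numerator away from
zero there. -/
theorem one_add_hoefsmitCoeff_ne_zero (hα : n < orderOf α) (hβ0 : β ≠ 0)
    (hβ : ∀ i : ℤ, |i| ≤ (n : ℤ) - 1 → β ≠ -α ^ i) {f : l.Filling} (hf : StrictMono f)
    {i j : Fin n} (hij : j.1 = i.1 + 1) (h : StrictMono (f.exchange i j)) :
    1 + hoefsmitCoeff α β f i j ≠ 0 := by
  have hne := ct_ne hα (ne_zero_of hα) hβ0 hβ hf (i := i) (j := j) (by omega) (by omega)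
  rw [one_add_hoefsmitCoeff hα hβ0 hβ hf hij]
  refine div_ne_zero (sub_ne_zero.2 (mul_ct_ne hα hβ0 hβ ?_ ?_)) (sub_ne_zero.2 hne.symm)
  · exact not_lt_of_le hf (by rw [Fin.le_def]; omega)
  · exact (strictMono_exchange_iff hf hij).1 h

/-! ### The representation on generators and Jucys-Murphy elements -/

/-- The `k`-th generator of the Artin group. -/
def artinGen (k : Fin n) : ArtinB n := PresentedGroup.of k

theorem hoefsmitRep_gen (hα : n < orderOf α) (hβ0 : β ≠ 0)
    (hβ : ∀ i : ℤ, |i| ≤ (n : ℤ) - 1 → β ≠ -α ^ i) (l : DoublePartition n) (k : Fin n) :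
    (hoefsmitRep hα hβ0 hβ l (artinGen k) : Matrix l.StdTableau l.StdTableau K) =
      hoefsmitGen α β l k := by
  rw [hoefsmitRep, artinGen, PresentedGroup.toGroup.of]
  rfl

theorem hoefsmitGen_zero {k : Fin n} (hk : k.1 = 0) :
    hoefsmitGen α β l k = hoefsmitT β l k := if_pos hk

theorem hoefsmitGen_succ {i j : Fin n} (hij : j.1 = i.1 + 1) :
    hoefsmitGen α β l j = hoefsmitS α β l i j := by
  rw [hoefsmitGen, if_neg (by omega)]
  congr 1
  exact Fin.ext (by simp; omega)

theorem artinGen_braid {i j : Fin n} (hi : 1 ≤ i.1) (hij : j.1 = i.1 + 1) :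
    artinGen i * artinGen j * artinGen i = artinGen j * artinGen i * artinGen j := by
  have h : FreeGroup.of i * FreeGroup.of j * FreeGroup.of i *
      (FreeGroup.of j * FreeGroup.of i * FreeGroup.of j)⁻¹ ∈ artinBRels n :=
    Or.inl (Or.inr ⟨i, j, hi, hij, rfl⟩)
  have := PresentedGroup.one_of_mem h
  rw [map_mul, map_inv, mul_inv_eq_one] at this
  simp only [map_mul] at this
  exact this

/-- The smallest entry sits in a corner, where the power of `α` is trivial. Hence `T` acts by the
content of the first entry and can start the recursion for Jucys-Murphy elements. -/
theorem boxContent_first {f : l.Filling} (hf : StrictMono f) {a : Fin n} (ha : a.1 = 0) :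
    boxContent α β (f.symm a) = if (f.symm a).1 = 0 then β else -1 := by
  obtain ⟨k, x, hx⟩ : ∃ k x, f.symm a = ⟨k, x⟩ := ⟨_, _, rfl⟩
  have ex : f ⟨k, x⟩ = a := by rw [← hx, Equiv.apply_symm_apply]
  have : (x.1.1, x.1.2) = (0, 0) := by
    by_contra hne
    obtain ⟨o, ho⟩ := origin hf hne
    rw [ex, Fin.lt_def] at ho
    omega
  simp only [Prod.mk.injEq] at this
  rw [hx]
  simp [boxContent, Box.row, Box.col, this.1, this.2]

/-- Conjugating a diagonal matrix of contents at `i` gives the one at `i + 1`. -/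
theorem hoefsmitS_mul_diagonal_mul (hα : n < orderOf α) (hβ0 : β ≠ 0)
    (hβ : ∀ i : ℤ, |i| ≤ (n : ℤ) - 1 → β ≠ -α ^ i) {i j : Fin n} (hij : j.1 = i.1 + 1) :
    hoefsmitS α β l i j * Matrix.diagonal (fun T => boxContent α β (T.1.symm i)) *
      hoefsmitS α β l i j = α • Matrix.diagonal (fun T => boxContent α β (T.1.symm j)) := by
  have h0 := ne_zero_of hα
  have hdiag : ∀ (k : Fin n) (g : l.Filling),
      Matrix.diagonal (fun T : l.StdTableau => boxContent α β (T.1.symm k)) *ᵥ fillingVec K g =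
        boxContent α β (g.symm k) • fillingVec K g := by
    intro k g
    funext T
    simp only [Matrix.mulVec_diagonal, Pi.smul_apply, smul_eq_mul]
    by_cases h : T.1 = g
    · rw [h]
    · simp [fillingVec, h]
  apply ext_fillingVec
  intro f hf
  have hne := ct_ne hα h0 hβ0 hβ hf (i := i) (j := j) (by omega) (by omega)
  have hx := ct_ne_zero (l := l) h0 hβ0 (f.symm i)
  have hy := ct_ne_zero (l := l) h0 hβ0 (f.symm j)
  have b1 := act_back hα hβ0 hβ hf hij
  have a1 := act_std (α := α) (β := β) hf i j
  have hsum := coeff_swap hα hβ0 hβ hf hij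
  -- This relation kills the coefficient of the exchanged tableau and leaves `α ct(j)` on the
  -- diagonal.
  have rel : hoefsmitCoeff α β f i j * boxContent α β (f.symm i) +
      hoefsmitCoeff α β f j i * boxContent α β (f.symm j) = 0 := by
    unfold hoefsmitCoeff
    rw [coeff_eq hy hne, coeff_eq hx hne.symm]
    generalize boxContent α β (f.symm i) = x at *
    generalize boxContent α β (f.symm j) = y at *
    have h1 : y - x ≠ 0 := sub_ne_zero.2 hne.symm
    have h2 : x - y = -(y - x) := by ring
    rw [h2]
    field_simp
    ring
  have d0 := hdiag i f
  have d1 := hdiag i (f.exchange i j)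
  rw [exchange_symm, Equiv.swap_apply_left] at d1
  rw [Matrix.smul_mulVec, hdiag j f]
  simp only [← Matrix.mulVec_mulVec]
  generalize hoefsmitCoeff α β f i j = p at *
  generalize hoefsmitCoeff α β f j i = p' at *
  generalize boxContent α β (f.symm i) = x at *
  generalize boxContent α β (f.symm j) = y at *
  generalize hoefsmitS α β l i j = S at *
  generalize Matrix.diagonal (fun T : l.StdTableau => boxContent α β (T.1.symm i)) = D at *
  generalize fillingVec K f = v at *
  generalize fillingVec K (f.exchange i j) = w at *
  have M : S *ᵥ D *ᵥ S *ᵥ v = (x * p) • S *ᵥ v + y • ((1 + p) • S *ᵥ w) := by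
    conv_lhs => rw [a1]
    simp only [Matrix.mulVec_add, Matrix.mulVec_smul, d0, d1]
    module
  rw [M, b1, a1]
  subst hsum
  match_scalars
  · linear_combination p * rel
  · linear_combination (1 + p) * rel

/-- Jucys-Murphy elements: for each `k`, some element of the Artin group acts diagonally in all the
representations, by the contents at `k` up to a common nonzero factor. -/
theorem exists_jucysMurphy (hα : n < orderOf α) (hβ0 : β ≠ 0)
    (hβ : ∀ i : ℤ, |i| ≤ (n : ℤ) - 1 → β ≠ -α ^ i) (k : Fin n) :
    ∃ x : ArtinB n, ∀ l : DoublePartition n,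
      (hoefsmitRep hα hβ0 hβ l x : Matrix l.StdTableau l.StdTableau K) =
        α ^ k.1 • Matrix.diagonal (fun T => boxContent α β (T.1.symm k)) := by
  obtain ⟨k, hk⟩ := k
  induction k with
  | zero =>
    refine ⟨artinGen ⟨0, hk⟩, fun l => ?_⟩
    rw [hoefsmitRep_gen, hoefsmitGen_zero rfl, hoefsmitT, pow_zero, one_smul]
    congr 1
    funext T
    rw [boxContent_first T.2 rfl]
  | succ k ih =>
    obtain ⟨x, hx⟩ := ih (by omega)
    -- The recursion `x ↦ S x S`; each step contributes one factor `α`, the same for all shapes.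
    refine ⟨artinGen ⟨k + 1, hk⟩ * x * artinGen ⟨k + 1, hk⟩, fun l => ?_⟩
    rw [map_mul, map_mul, Units.val_mul, Units.val_mul, hx, hoefsmitRep_gen,
      hoefsmitGen_succ (i := ⟨k, by omega⟩) rfl, Matrix.mul_smul, Matrix.smul_mul,
      hoefsmitS_mul_diagonal_mul hα hβ0 hβ rfl, smul_smul, pow_succ]

/-! ### Intertwiners up to a character -/

section Matching

variable {hα : n < orderOf α} {hβ0 : β ≠ 0} {hβ : ∀ i : ℤ, |i| ≤ (n : ℤ) - 1 → β ≠ -α ^ i}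
  {χ : ArtinB n →* K} {P : Matrix l.StdTableau m.StdTableau K}

/-- `P` intertwines `R_m` and `R_l` up to the character `χ`. -/
def SemiIntertwines (hα : n < orderOf α) (hβ0 : β ≠ 0)
    (hβ : ∀ i : ℤ, |i| ≤ (n : ℤ) - 1 → β ≠ -α ^ i) (χ : ArtinB n →* K)
    (P : Matrix l.StdTableau m.StdTableau K) : Prop :=
  ∀ g, (hoefsmitRep hα hβ0 hβ l g : Matrix l.StdTableau l.StdTableau K) * P =
    χ g • (P * (hoefsmitRep hα hβ0 hβ m g : Matrix m.StdTableau m.StdTableau K))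

/-- At a Jucys-Murphy element `x` both sides of the intertwining relation involve diagonal matrices,
so a nonzero entry of `P` equates the two contents up to `χ x`. -/
theorem exists_content_ratio (H : SemiIntertwines hα hβ0 hβ χ P)
    (k : Fin n) : ∃ c : K, c ≠ 0 ∧
    (χ = 1 → c = 1) ∧ ∀ T U, P T U ≠ 0 →
      boxContent α β (T.1.symm k) = c * boxContent α β (U.1.symm k) := by
  obtain ⟨x, hx⟩ := exists_jucysMurphy hα hβ0 hβ k
  refine ⟨χ x, ?_, fun h => by rw [h, MonoidHom.one_apply], fun T U hTU => ?_⟩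
  · intro h
    have := congrArg χ (mul_inv_cancel x)
    rw [map_mul, h, zero_mul, map_one] at this
    exact zero_ne_one this
  · have := congrFun (congrFun (H x) T) U
    rw [hx, hx, Matrix.smul_mul, Matrix.mul_smul, Matrix.smul_apply, Matrix.smul_apply,
      Matrix.smul_apply, Matrix.diagonal_mul, Matrix.mul_diagonal] at this
    have hp := pow_ne_zero k.1 (ne_zero_of hα)
    simp only [smul_eq_mul] at this
    refine mul_left_cancel₀ hp (mul_right_cancel₀ hTU ?_)
    linear_combination this

/-- Two partners of `T` have contents proportional to those of `T` with the same factors, hence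
equal contents. Each row of `P` thus has at most one nonzero entry; the same holds for columns. -/
theorem match_right_unique (H : SemiIntertwines hα hβ0 hβ χ P)
    {T : l.StdTableau} {U U' : m.StdTableau} (h : P T U ≠ 0)
    (h' : P T U' ≠ 0) : U = U' := by
  refine stdTableau_eq_of_content_eq hα hβ0 hβ fun k => ?_
  obtain ⟨c, hc, _, hk⟩ := exists_content_ratio H k
  exact mul_left_cancel₀ hc ((hk T U h).symm.trans (hk T U' h'))

theorem match_left_unique (H : SemiIntertwines hα hβ0 hβ χ P)
    {T T' : l.StdTableau} {U : m.StdTableau} (h : P T U ≠ 0)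
    (h' : P T' U ≠ 0) : T = T' := by
  refine stdTableau_eq_of_content_eq hα hβ0 hβ fun k => ?_
  obtain ⟨c, hc, _, hk⟩ := exists_content_ratio H k
  exact (hk T U h).trans (hk T' U h').symm

theorem mul_apply_of_match (H : SemiIntertwines hα hβ0 hβ χ P)
    (M : Matrix l.StdTableau l.StdTableau K) {T : l.StdTableau}
    {U : m.StdTableau} (h : P T U ≠ 0) (T' : l.StdTableau) : (M * P) T' U = M T' T * P T U := by
  rw [Matrix.mul_apply, Finset.sum_eq_single T]
  · intro T₁ _ hne
    by_contra hcon
    exact hne (match_left_unique H (right_ne_zero_of_mul hcon) h)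
  · simp

theorem apply_mul_of_match (H : SemiIntertwines hα hβ0 hβ χ P)
    (M : Matrix m.StdTableau m.StdTableau K) {T : l.StdTableau}
    {U : m.StdTableau} (h : P T U ≠ 0) (U' : m.StdTableau) : (P * M) T U' = P T U * M U U' := by
  rw [Matrix.mul_apply, Finset.sum_eq_single U]
  · intro U₁ _ hne
    by_contra hcon
    exact hne (match_right_unique H (left_ne_zero_of_mul hcon) h)
  · simp

theorem diag_eq_of_match (H : SemiIntertwines hα hβ0 hβ χ P)
    {T : l.StdTableau} {U : m.StdTableau} (h : P T U ≠ 0) (k : Fin n) :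
    hoefsmitGen α β l k T T = χ (artinGen k) * hoefsmitGen α β m k U U := by
  have := congrFun (congrFun (H (artinGen k)) T) U
  rw [hoefsmitRep_gen, hoefsmitRep_gen, Matrix.smul_apply, mul_apply_of_match H _ h,
    apply_mul_of_match H _ h, smul_eq_mul] at this
  refine mul_right_cancel₀ h ?_
  linear_combination this

/-- The matching defined by the support of `P` is compatible with exchanges. -/
theorem exists_match_exchange (H : SemiIntertwines hα hβ0 hβ χ P)
    {T T' : l.StdTableau} {U : m.StdTableau} (h : P T U ≠ 0)
    {i j : Fin n} (hij : j.1 = i.1 + 1) (hT' : T'.1 = T.1.exchange i j) :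
    ∃ U' : m.StdTableau, U'.1 = U.1.exchange i j ∧ P T' U' ≠ 0 := by
  have hne : i ≠ j := fun e => by rw [e] at hij; omega
  have := congrFun (congrFun (H (artinGen j)) T') U
  rw [hoefsmitRep_gen, hoefsmitRep_gen, hoefsmitGen_succ hij, hoefsmitGen_succ hij,
    Matrix.smul_apply, mul_apply_of_match H _ h, hoefsmitS_apply_exchange hne hT'] at this
  -- The `(T', U)` entry of the left side is nonzero, so some `U'` contributes on the right. It is
  -- not `U`, whose only partner is `T`, so it must be the exchange of `U`.
  have hnz : (1 + hoefsmitCoeff α β T.1 i j) * P T U ≠ 0 :=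
    mul_ne_zero (one_add_hoefsmitCoeff_ne_zero hα hβ0 hβ T.2 hij (hT' ▸ T'.2)) h
  rw [this, smul_eq_mul] at hnz
  have hsum := right_ne_zero_of_mul hnz
  rw [Matrix.mul_apply] at hsum
  obtain ⟨U', _, hU'⟩ := Finset.exists_ne_zero_of_sum_ne_zero hsum
  have hP := left_ne_zero_of_mul hU'
  refine ⟨U', ?_, hP⟩
  by_contra hcon
  have hUU : U' ≠ U := by
    rintro rfl
    have e := match_left_unique H hP h
    exact exchange_ne T.1 hne (by rw [← hT', e])
  exact right_ne_zero_of_mul hU' (hoefsmitS_apply_of_ne hUU hcon)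

/-- Some matched tableau has its first two entries in different components. -/
theorem exists_match_first_two (H : SemiIntertwines hα hβ0 hβ χ P)
    (hl : l.NoEmptyComponent) (hP : P ≠ 0) :
    ∃ (a b : Fin n) (T : l.StdTableau) (U : m.StdTableau), a.1 = 0 ∧ b.1 = 1 ∧ P T U ≠ 0 ∧
      (T.1.symm a).1 ≠ (T.1.symm b).1 := by
  classical
  obtain ⟨T₀, U₀, h₀⟩ : ∃ T U, P T U ≠ 0 := by
    by_contra! hcon
    exact hP (Matrix.ext hcon)
  have hn : 0 < n := by
    have h1 : l.fst.card ≠ 0 := by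
      intro h
      exact hl.1 (YoungDiagram.ext (Finset.card_eq_zero.1 h))
    have := l.card_add
    omega
  -- The least `k` is taken such that, in some matched tableau, the entries `0` and `k` lie in
  -- different components. Non-emptiness of both components makes such a `k` exist.
  have hex : ∃ k : ℕ, ∃ (hk : k < n) (T : l.StdTableau) (U : m.StdTableau), P T U ≠ 0 ∧
      (T.1.symm ⟨0, hn⟩).1 ≠ (T.1.symm ⟨k, hk⟩).1 := by
    obtain ⟨b, hb⟩ : ∃ b : l.Box, (T₀.1.symm ⟨0, hn⟩).1 ≠ b.1 := by
      have hbox : ∀ q : Fin 2, ∃ b : l.Box, b.1 = q := by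
        intro q
        have hq : l.comp q ≠ ⊥ := by
          rcases fin_two_cases q with rfl | rfl
          · exact hl.1
          · exact hl.2
        obtain ⟨x, hx⟩ : (l.comp q).cells.Nonempty := by
          rw [Finset.nonempty_iff_ne_empty]
          exact fun h => hq (YoungDiagram.ext h)
        exact ⟨⟨q, x, hx⟩, rfl⟩
      rcases fin_two_cases (T₀.1.symm ⟨0, hn⟩).1 with e | e
      · obtain ⟨b, hb⟩ := hbox 1
        exact ⟨b, by rw [e, hb]; exact zero_ne_one⟩
      · obtain ⟨b, hb⟩ := hbox 0
        exact ⟨b, by rw [e, hb]; exact one_ne_zero⟩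
    exact ⟨(T₀.1 b).1, (T₀.1 b).2, T₀, U₀, h₀, by simpa using hb⟩
  obtain ⟨hk, T, U, hTU, hne⟩ := Nat.find_spec hex
  set k := Nat.find hex with hkdef
  have hk0 : k ≠ 0 := by
    intro h
    apply hne
    congr 2
    exact Fin.ext h.symm
  by_cases hk1 : k = 1
  · exact ⟨⟨0, hn⟩, ⟨k, hk⟩, T, U, rfl, hk1, hTU, hne⟩
  · exfalso
    have hlt : k - 1 < k := by omega
    have hsame : (T.1.symm ⟨0, hn⟩).1 = (T.1.symm ⟨k - 1, by omega⟩).1 := by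
      by_contra hcon
      exact Nat.find_min hex hlt ⟨by omega, T, U, hTU, hcon⟩
    have hij : (⟨k, hk⟩ : Fin n).1 = (⟨k - 1, by omega⟩ : Fin n).1 + 1 := by simp; omega
    -- If `k > 1`, the entry `k - 1` shares the component of `0`, so it can be exchanged with `k`;
    -- the resulting matched tableau contradicts minimality.
    have hstd : StrictMono (T.1.exchange ⟨k - 1, by omega⟩ ⟨k, hk⟩) :=
      (strictMono_exchange_iff T.2 hij).2 (not_lt_of_fst_ne (by rw [← hsame]; exact hne))
    obtain ⟨U', _, hU'⟩ := exists_match_exchange H hTU hij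
      (T' := ⟨T.1.exchange ⟨k - 1, by omega⟩ ⟨k, hk⟩, hstd⟩) rfl
    refine Nat.find_min hex hlt ⟨by omega, _, U', hU', ?_⟩
    rw [exchange_symm, exchange_symm, Equiv.swap_apply_left, Equiv.swap_apply_of_ne_of_ne]
    · exact hne
    · simp [Fin.ext_iff]; omega
    · simp [Fin.ext_iff]; omega

/-- A matched pair with the first two entries of `T` in different components, together with its
exchange, determines `χ` on the first two generators. The braid relations do the rest. -/
theorem character_eq_one (H : SemiIntertwines hα hβ0 hβ χ P)
    (hβ1 : β ≠ 1) (hl : l.NoEmptyComponent) (hP : P ≠ 0) : χ = 1 := by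
  obtain ⟨a, b, T, U, ha, hb, hTU, hne⟩ := exists_match_first_two H hl hP
  have hab : b.1 = a.1 + 1 := by omega
  have hab' : a ≠ b := fun e => by rw [e] at hab; omega
  have hstd := (strictMono_exchange_iff T.2 hab).2 (not_lt_of_fst_ne hne)
  obtain ⟨T', hT'⟩ : ∃ T' : l.StdTableau, T'.1 = T.1.exchange a b := ⟨⟨_, hstd⟩, rfl⟩
  obtain ⟨U', hU', hTU'⟩ := exists_match_exchange H hTU hab hT'
  have hn : 2 ≤ n := by omega
  have hα1 : α ≠ 1 := by
    rintro rfl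
    rw [orderOf_one] at hα
    omega
  have hβm : β ≠ -1 := by simpa using hβ 0 (by rw [abs_zero]; omega)
  -- The diagonal entries at a tableau and at its exchange add up to `α - 1` for either shape, so
  -- summing the two equations gives `α - 1 = χ(S_1) (α - 1)`.
  have u1 : χ (artinGen b) = 1 := by
    have e1 := diag_eq_of_match H hTU b
    have e2 := diag_eq_of_match H hTU' b
    rw [hoefsmitGen_succ hab, hoefsmitGen_succ hab, hoefsmitS_apply_self _ hab',
      hoefsmitS_apply_self _ hab'] at e1 e2
    rw [hT', hU', hoefsmitCoeff_exchange, hoefsmitCoeff_exchange, coeff_swap hα hβ0 hβ T.2 hab,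
      coeff_swap hα hβ0 hβ U.2 hab] at e2
    refine mul_right_cancel₀ (sub_ne_zero.2 hα1) ?_
    linear_combination - e1 - e2
  -- On `T` and `T'` the eigenvalues of the first generator are `β` and `-1` in some order. On `U`
  -- and `U'` they come in the same order, which gives `χ = 1`; reversed, which gives `β² = 1`; or
  -- equal, which gives `β = -1`.
  have v1 : χ (artinGen a) = 1 := by
    have e1 := diag_eq_of_match H hTU a
    have e2 := diag_eq_of_match H hTU' a
    rw [hoefsmitGen_zero ha, hoefsmitGen_zero ha, hoefsmitT, hoefsmitT, Matrix.diagonal_apply_eq,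
      Matrix.diagonal_apply_eq] at e1 e2
    rw [hT', hU', exchange_symm, exchange_symm, Equiv.swap_apply_left] at e2
    have hβ2 : β * β ≠ 1 := by
      intro h
      rcases mul_self_eq_one_iff.1 h with h | h
      · exact hβ1 h
      · exact hβm h
    generalize χ (artinGen a) = v at e1 e2
    rcases fin_two_cases (T.1.symm a).1 with t1 | t1 <;>
      rcases fin_two_cases (T.1.symm b).1 with t2 | t2 <;>
      rcases fin_two_cases (U.1.symm a).1 with t3 | t3 <;>
      rcases fin_two_cases (U.1.symm b).1 with t4 | t4 <;>
      simp only [t1, t2, t3, t4, if_true, one_ne_zero, if_false, ne_eq, not_true_eq_false]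
        at e1 e2 hne
    · exact absurd (e1.trans e2.symm) hβm
    · linear_combination e2
    · exfalso
      apply hβ2
      linear_combination β * e1 + e2
    · exact absurd (e1.trans e2.symm) hβm
    · exact absurd (e2.trans e1.symm) hβm
    · exfalso
      apply hβ2
      linear_combination β * e2 + e1
    · linear_combination e1
    · exact absurd (e2.trans e1.symm) hβm
  have hgen : ∀ k, χ (artinGen k) = 1 := by
    rintro ⟨k, hk⟩
    induction k with
    | zero => rwa [show (⟨0, hk⟩ : Fin n) = a from Fin.ext ha.symm]
    | succ k ih =>
      rcases Nat.eq_zero_or_pos k with rfl | hpos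
      · rwa [show (⟨0 + 1, hk⟩ : Fin n) = b from Fin.ext hb.symm]
      · have hk' := ih (by omega)
        -- If one side of a braid relation of length three has value `1`, the other value `t`
        -- satisfies `t = t²`, and it is invertible.
        have hbr := congrArg χ (artinGen_braid (n := n) (i := ⟨k, by omega⟩) (j := ⟨k + 1, hk⟩)
          hpos rfl)
        simp only [map_mul, hk', one_mul, mul_one] at hbr
        have hinv : χ (artinGen ⟨k + 1, hk⟩) * χ (artinGen ⟨k + 1, hk⟩)⁻¹ = 1 := by
          rw [← map_mul, mul_inv_cancel, map_one]
        refine mul_right_cancel₀ (left_ne_zero_of_mul (hinv.trans_ne one_ne_zero)) ?_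
        rw [one_mul, ← hbr]
  have hu : χ.toHomUnits = 1 := by
    apply PresentedGroup.ext
    intro k
    apply Units.ext
    exact hgen k
  ext g
  exact congrArg Units.val (DFunLike.congr_fun hu g)

theorem eq_of_semi_intertwiner (H : SemiIntertwines hα hβ0 hβ χ P)
    (hβ1 : β ≠ 1) (hl : l.NoEmptyComponent) (hP : P ≠ 0) : l = m := by
  have hχ := character_eq_one H hβ1 hl hP
  obtain ⟨T, U, hTU⟩ : ∃ T U, P T U ≠ 0 := by
    by_contra! hcon
    exact hP (Matrix.ext hcon)
  refine eq_of_content_eq hα hβ0 hβ T.2 U.2 fun k => ?_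
  obtain ⟨c, _, hc, h⟩ := exists_content_ratio H k
  rw [h T U hTU, hc hχ, one_mul]

end Matching

/-! ### Change of base field -/

section Map

variable {F : Type*} [Field F] (φ : K →+* F)

theorem lt_orderOf_map (hα : n < orderOf α) : n < orderOf (φ α) := by
  have := orderOf_injective (φ : K →* F) φ.injective α
  exact lt_of_lt_of_eq hα this.symm

theorem map_ne_neg_zpow (hβ : ∀ i : ℤ, |i| ≤ (n : ℤ) - 1 → β ≠ -α ^ i) :
    ∀ i : ℤ, |i| ≤ (n : ℤ) - 1 → φ β ≠ -φ α ^ i := by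
  intro i hi h
  rw [← map_zpow₀, ← map_neg] at h
  exact hβ i hi (φ.injective h)

theorem map_boxContent (b : l.Box) : φ (boxContent α β b) = boxContent (φ α) (φ β) b := by
  unfold boxContent
  split_ifs <;> simp

/-- The entries are rational expressions in `α` and `β` over the prime field, so a field map only
moves the parameters. This serves both the passage to the algebraic closure and the twists. -/
theorem map_hoefsmitGen (k : Fin n) :
    (hoefsmitGen α β l k).map φ = hoefsmitGen (φ α) (φ β) l k := by
  ext T' T
  unfold hoefsmitGen
  split_ifs with hk
  · simp only [hoefsmitT, Matrix.map_apply, Matrix.diagonal_apply]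
    split_ifs <;> simp
  · simp only [hoefsmitS, Matrix.map_apply, Matrix.of_apply, hoefsmitCoeff, fillingVec, map_add,
      map_mul, map_div₀, map_sub, map_one, map_boxContent]
    congr 2 <;> split_ifs <;> simp

theorem map_hoefsmitRep (hα : n < orderOf α) (hβ0 : β ≠ 0)
    (hβ : ∀ i : ℤ, |i| ≤ (n : ℤ) - 1 → β ≠ -α ^ i) (l : DoublePartition n) :
    (Matrix.GeneralLinearGroup.map φ).comp (hoefsmitRep hα hβ0 hβ l) =
      hoefsmitRep (lt_orderOf_map φ hα) ((map_ne_zero φ).2 hβ0) (map_ne_neg_zpow φ hβ) l := by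
  apply PresentedGroup.ext
  intro k
  apply Units.ext
  change ((hoefsmitRep hα hβ0 hβ l (artinGen k) : Matrix l.StdTableau l.StdTableau K)).map φ =
    (hoefsmitRep (lt_orderOf_map φ hα) ((map_ne_zero φ).2 hβ0) (map_ne_neg_zpow φ hβ) l
      (artinGen k) : Matrix l.StdTableau l.StdTableau F)
  rw [hoefsmitRep_gen, hoefsmitRep_gen, map_hoefsmitGen]

end Map

/-- A linear extension of the order on boxes, enumerated increasingly, is a standard tableau. -/
theorem nonempty_stdTableau (l : DoublePartition n) : Nonempty l.StdTableau := by
  let : Fintype (LinearExtension l.Box) := inferInstanceAs (Fintype l.Box)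
  have hcard : Fintype.card (LinearExtension l.Box) = n := by
    change Fintype.card l.Box = n
    rw [Fintype.card_sigma, Fin.sum_univ_two, Fintype.card_coe, Fintype.card_coe]
    exact card_comp l
  let e := (monoEquivOfFin (LinearExtension l.Box) hcard).symm
  refine ⟨⟨e.toEquiv, ?_⟩⟩
  intro A B hAB
  have hle : toLinearExtension A ≤ toLinearExtension B := toLinearExtension.monotone hAB.le
  exact e.strictMono (lt_of_le_of_ne hle hAB.ne)

/-- Representations of different shapes stay non-isomorphic on the derived subgroup. -/
theorem eq_of_iso_derived {hα : n < orderOf α} {hβ0 : β ≠ 0}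
    {hβ : ∀ i : ℤ, |i| ≤ (n : ℤ) - 1 → β ≠ -α ^ i} (hβ1 : β ≠ 1) (hl : l.NoEmptyComponent)
    (h : MatrixRep.Iso (hoefsmitRepDerived hα hβ0 hβ l) (hoefsmitRepDerived hα hβ0 hβ m)) :
    l = m := by
  obtain ⟨P, Q, hPQ, -, hP⟩ := h
  -- The joint eigenvector may exist only after extending scalars; the conditions on `α` and `β`
  -- survive.
  let φ := algebraMap K (AlgebraicClosure K)
  have hP0 : P.map φ ≠ 0 := by
    intro h0
    have hP0 : P = 0 := by
      ext T U
      have := congrFun (congrFun h0 T) U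
      simpa using this
    obtain ⟨T⟩ := nonempty_stdTableau l
    rw [hP0, Matrix.zero_mul] at hPQ
    have := congrFun (congrFun hPQ T) T
    simp at this
  obtain ⟨P', hP', χ, H⟩ := MatrixRep.exists_semi_intertwiner
    (ρ := hoefsmitRep (lt_orderOf_map φ hα) ((map_ne_zero φ).2 hβ0) (map_ne_neg_zpow φ hβ) l)
    (σ := hoefsmitRep (lt_orderOf_map φ hα) ((map_ne_zero φ).2 hβ0) (map_ne_neg_zpow φ hβ) m)
    hP0 (fun g hg => by
      have := congrArg (fun M => M.map φ) (hP ⟨g, hg⟩)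
      simp only [Matrix.map_mul] at this
      rw [← map_hoefsmitRep, ← map_hoefsmitRep]
      exact this)
  exact eq_of_semi_intertwiner H ((map_ne_one_iff φ φ.injective).2 hβ1) hl hP'

end HoefsmitAux

namespace HoefsmitAux

open DoublePartition

variable {n : ℕ} {K : Type*} [Field K] {α β : K} {l m : DoublePartition n}

/-! ### Relabelling of boxes -/

theorem box_le_iff {A B : l.Box} : A ≤ B ↔ A.1 = B.1 ∧ A.2.1 ≤ B.2.1 := by
  obtain ⟨k, a⟩ := A
  obtain ⟨k', b⟩ := B
  constructor
  · intro h
    obtain ⟨hk, h⟩ := Sigma.le_def.1 h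
    simp only at hk
    subst hk
    exact ⟨rfl, h⟩
  · rintro ⟨hk, h⟩
    simp only at hk
    subst hk
    exact Sigma.mk_le_mk_iff.2 h

/-- The isomorphism of posets of boxes given by a permutation of the two components and an
automorphism of the poset of cells. -/
def boxIso (τ : Equiv.Perm (Fin 2)) (s : ℕ × ℕ ≃o ℕ × ℕ)
    (h : ∀ k x, x ∈ (l.comp k).cells ↔ s x ∈ (m.comp (τ k)).cells) : l.Box ≃o m.Box where
  toFun b := ⟨τ b.1, s b.2.1, (h _ _).1 b.2.2⟩
  invFun b := ⟨τ.symm b.1, s.symm b.2.1, (h _ _).2 (by simp)⟩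
  left_inv b := boxPos_injective (by simp [boxPos])
  right_inv b := boxPos_injective (by simp [boxPos])
  map_rel_iff' := by
    intro A B
    simp [box_le_iff]

/-- The boxes of the transpose of a double-partition. -/
def transposeBoxIso (m : DoublePartition n) : m.transpose.Box ≃o m.Box :=
  boxIso (Equiv.swap 0 1) OrderIso.prodComm fun k x => by
    rcases fin_two_cases k with rfl | rfl <;>
      simp [comp, DoublePartition.transpose, YoungDiagram.mem_cells, YoungDiagram.mem_transpose]

/-- The boxes of the double-partition with both components transposed. -/
def transposeEachBoxIso (m : DoublePartition n) : m.transposeEach.Box ≃o m.Box :=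
  boxIso 1 OrderIso.prodComm fun k x => by
    rcases fin_two_cases k with rfl | rfl <;>
      simp [comp, transposeEach, YoungDiagram.mem_cells, YoungDiagram.mem_transpose]

/-- The boxes of the double-partition with the components interchanged. -/
def swapBoxIso (m : DoublePartition n) : m.swap.Box ≃o m.Box :=
  boxIso (Equiv.swap 0 1) (OrderIso.refl _) fun k x => by
    rcases fin_two_cases k with rfl | rfl <;> simp [comp, DoublePartition.swap]

theorem boxContent_boxIso {τ : Equiv.Perm (Fin 2)} {s : ℕ × ℕ ≃o ℕ × ℕ}
    {h : ∀ k x, x ∈ (l.comp k).cells ↔ s x ∈ (m.comp (τ k)).cells} (b : l.Box) :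
    boxContent α β (boxIso τ s h b) =
      if τ b.1 = 0 then β * α ^ (((s (b.row, b.col)).2 : ℤ) - (s (b.row, b.col)).1)
      else -α ^ (((s (b.row, b.col)).2 : ℤ) - (s (b.row, b.col)).1) := rfl

/-- Transposition inverts the power of `α`, and the swap exchanges `β` with `-1`; the content of a
box and that of its image always have product `-β`. -/
theorem content_transposeBoxIso (hβ0 : β ≠ 0) (b : m.transpose.Box) :
    boxContent α β (transposeBoxIso m b) = -β * (boxContent α β b)⁻¹ := by
  rw [transposeBoxIso, boxContent_boxIso, boxContent]
  have e : α ^ ((b.row : ℤ) - b.col) = (α ^ ((b.col : ℤ) - b.row))⁻¹ := by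
    rw [← zpow_neg, neg_sub]
  rcases fin_two_cases b.1 with hb | hb
  · simp [hb, e, mul_left_comm β, hβ0]
  · simp [hb, e]

/-- Inverting `α` undoes the effect of transposition, and inverting `β` that of the swap up to
`-β⁻¹`. The two variants below use one of these effects each. -/
theorem content_inv_transposeBoxIso (hβ0 : β ≠ 0) (b : m.transpose.Box) :
    boxContent α⁻¹ β⁻¹ (transposeBoxIso m b) = -β⁻¹ * boxContent α β b := by
  rw [transposeBoxIso, boxContent_boxIso, boxContent]
  have e : α⁻¹ ^ ((b.row : ℤ) - b.col) = α ^ ((b.col : ℤ) - b.row) := by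
    rw [inv_zpow', neg_sub]
  rcases fin_two_cases b.1 with hb | hb <;> simp [hb, e, hβ0, -inv_zpow']

theorem content_transposeEachBoxIso (b : m.transposeEach.Box) :
    boxContent α⁻¹ β (transposeEachBoxIso m b) = boxContent α β b := by
  rw [transposeEachBoxIso, boxContent_boxIso, boxContent]
  have e : α⁻¹ ^ ((b.row : ℤ) - b.col) = α ^ ((b.col : ℤ) - b.row) := by
    rw [inv_zpow', neg_sub]
  rcases fin_two_cases b.1 with hb | hb <;> simp [hb, e, -inv_zpow']

theorem content_swapBoxIso (hβ0 : β ≠ 0) (b : m.swap.Box) :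
    boxContent α β⁻¹ (swapBoxIso m b) = -β⁻¹ * boxContent α β b := by
  rw [swapBoxIso, boxContent_boxIso, boxContent]
  rcases fin_two_cases b.1 with hb | hb <;> simp [hb, hβ0]

/-- Transport of standard tableaux along an isomorphism of posets of boxes. -/
def tableauEquiv (φ : l.Box ≃o m.Box) : l.StdTableau ≃ m.StdTableau where
  toFun T := ⟨φ.symm.toEquiv.trans T.1, T.2.comp φ.symm.strictMono⟩
  invFun U := ⟨φ.toEquiv.trans U.1, U.2.comp φ.strictMono⟩
  left_inv T := Subtype.ext (Equiv.ext fun b => by simp)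
  right_inv U := Subtype.ext (Equiv.ext fun b => by simp)

theorem tableauEquiv_apply (φ : l.Box ≃o m.Box) (T : l.StdTableau) (b : m.Box) :
    (tableauEquiv φ T).1 b = T.1 (φ.symm b) := rfl

theorem tableauEquiv_symm_apply (φ : l.Box ≃o m.Box) (T : l.StdTableau) (k : Fin n) :
    (tableauEquiv φ T).1.symm k = φ (T.1.symm k) := rfl

theorem tableauEquiv_exchange_iff (φ : l.Box ≃o m.Box) (T T' : l.StdTableau) (i j : Fin n) :
    (tableauEquiv φ T').1 = (tableauEquiv φ T).1.exchange i j ↔ T'.1 = T.1.exchange i j := by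
  constructor
  · intro h
    ext1 b
    have := congrArg (fun g : m.Filling => g (φ b)) h
    simpa only [exchange_apply, tableauEquiv_apply, OrderIso.symm_apply_apply] using this
  · intro h
    ext1 b
    rw [exchange_apply, tableauEquiv_apply, tableauEquiv_apply, h, exchange_apply]

/-! ### Monomial intertwiners -/

theorem closure_artinGen : Subgroup.closure (Set.range (artinGen (n := n))) = ⊤ :=
  PresentedGroup.closure_range_of _

/-- The intertwiner has the entry `w T` at `(T, e T)` and zeros elsewhere, which turns the matrix
relation on a generator into a relation between single entries. -/
theorem iso_of_monomial {ρ : ArtinB n →* GL l.StdTableau K} {σ : ArtinB n →* GL m.StdTableau K}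
    (e : l.StdTableau ≃ m.StdTableau) {w : l.StdTableau → K} (hw : ∀ T, w T ≠ 0)
    (h : ∀ k, ∃ c : K, c ≠ 0 ∧ ∀ T₁ T₂,
      (ρ (artinGen k) : Matrix l.StdTableau l.StdTableau K) T₁ T₂ * w T₂ =
        c * (w T₁ * (σ (artinGen k) : Matrix m.StdTableau m.StdTableau K) (e T₁) (e T₂))) :
    MatrixRep.Iso (ρ.comp (commutator (ArtinB n)).subtype)
      (σ.comp (commutator (ArtinB n)).subtype) := by
  refine MatrixRep.iso_commutator_of_generators closure_artinGen
    (P := (Matrix.diagonal w).submatrix id e.symm)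
    (Q := (Matrix.diagonal fun T => (w T)⁻¹).submatrix e.symm id) ?_ ?_ ?_
  · rw [Matrix.submatrix_mul_equiv, Matrix.diagonal_mul_diagonal]
    simp [hw]
  · rw [← Equiv.coe_refl, Matrix.submatrix_mul_equiv, Matrix.diagonal_mul_diagonal]
    simp [hw]
  · rintro _ ⟨k, rfl⟩
    obtain ⟨c, hc, hk⟩ := h k
    refine ⟨Units.mk0 c hc, ?_⟩
    ext T U
    obtain ⟨T₂, rfl⟩ := e.surjective U
    have e1 : ((ρ (artinGen k) : Matrix l.StdTableau l.StdTableau K) *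
        (Matrix.diagonal w).submatrix id e.symm) T (e T₂) =
        (ρ (artinGen k) : Matrix l.StdTableau l.StdTableau K) T T₂ * w T₂ := by
      rw [Matrix.mul_apply, Finset.sum_eq_single T₂] <;> simp +contextual
    have e2 : ((Matrix.diagonal w).submatrix id e.symm *
        (σ (artinGen k) : Matrix m.StdTableau m.StdTableau K)) T (e T₂) =
        w T * (σ (artinGen k) : Matrix m.StdTableau m.StdTableau K) (e T) (e T₂) := by
      rw [Matrix.mul_apply, Finset.sum_eq_single (e T)]
      · simp
      · intro U _ hU
        have : T ≠ e.symm U := fun h => hU (by rw [h, Equiv.apply_symm_apply])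
        simp [this]
      · simp
    rw [Matrix.smul_apply, e1, e2, hk, Units.val_mk0, smul_eq_mul]

/-- Only diagonal entries and entries at exchanged pairs can be nonzero. The weights cancel on the
diagonal, so they are constrained by `h2` alone. -/
theorem hoefsmitS_transfer {α' β' : K} (φ : l.Box ≃o m.Box) {w : l.StdTableau → K} {c : K}
    {i j : Fin n} (hij : i ≠ j)
    (h1 : ∀ T : l.StdTableau,
      hoefsmitCoeff α β T.1 i j = c * hoefsmitCoeff α' β' (tableauEquiv φ T).1 i j)
    (h2 : ∀ T T' : l.StdTableau, T'.1 = T.1.exchange i j →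
      (1 + hoefsmitCoeff α β T.1 i j) * w T =
        c * (w T' * (1 + hoefsmitCoeff α' β' (tableauEquiv φ T).1 i j)))
    (T₁ T₂ : l.StdTableau) :
    hoefsmitS α β l i j T₁ T₂ * w T₂ =
      c * (w T₁ * hoefsmitS α' β' m i j (tableauEquiv φ T₁) (tableauEquiv φ T₂)) := by
  by_cases h : T₁ = T₂
  · subst h
    rw [hoefsmitS_apply_self _ hij, hoefsmitS_apply_self _ hij, h1]
    ring
  · by_cases hx : T₁.1 = T₂.1.exchange i j
    · rw [hoefsmitS_apply_exchange hij hx,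
        hoefsmitS_apply_exchange hij ((tableauEquiv_exchange_iff φ _ _ _ _).2 hx), h2 _ _ hx]
    · rw [hoefsmitS_apply_of_ne h hx, hoefsmitS_apply_of_ne (fun h' => h (Equiv.injective _ h'))
        (fun h' => hx ((tableauEquiv_exchange_iff φ _ _ _ _).1 h'))]
      ring

/-- The coefficient depends only on the ratio of two contents, so the factor `γ` disappears. -/
theorem hoefsmitCoeff_transfer {α' β' γ : K} (hγ : γ ≠ 0) (φ : l.Box ≃o m.Box)
    (hφ : ∀ b, boxContent α' β' (φ b) = γ * boxContent α β b) (T : l.StdTableau) (i j : Fin n) :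
    hoefsmitCoeff α' β' (tableauEquiv φ T).1 i j =
      (α' - 1) / (1 - boxContent α β (T.1.symm i) / boxContent α β (T.1.symm j)) := by
  rw [hoefsmitCoeff, tableauEquiv_symm_apply, tableauEquiv_symm_apply, hφ, hφ,
    mul_div_mul_left _ _ hγ]

theorem hoefsmitT_transfer {α' β' γ : K} (φ : l.Box ≃o m.Box)
    (hφ : ∀ b, boxContent α' β' (φ b) = γ * boxContent α β b) (hγ : γ ≠ 0) {w : l.StdTableau → K}
    {i : Fin n} (hi : i.1 = 0) (T₁ T₂ : l.StdTableau) :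
    hoefsmitT β l i T₁ T₂ * w T₂ =
      γ⁻¹ * (w T₁ * hoefsmitT β' m i (tableauEquiv φ T₁) (tableauEquiv φ T₂)) := by
  by_cases h : T₁ = T₂
  · subst h
    rw [hoefsmitT, hoefsmitT, Matrix.diagonal_apply_eq, Matrix.diagonal_apply_eq,
      ← boxContent_first (α := α) T₁.2 hi, ← boxContent_first (α := α') (tableauEquiv φ T₁).2 hi,
      tableauEquiv_symm_apply, hφ]
    field_simp
  · rw [hoefsmitT, hoefsmitT, Matrix.diagonal_apply_ne _ h,
      Matrix.diagonal_apply_ne _ (fun h' => h (Equiv.injective _ h'))]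
    ring

theorem hoefsmitCoeff_inv (f : l.Filling) (h0 : α ≠ 0) (i j : Fin n) :
    (α⁻¹ - 1) / (1 - boxContent α β (f.symm i) / boxContent α β (f.symm j)) =
      -α⁻¹ * hoefsmitCoeff α β f i j := by
  rw [hoefsmitCoeff, ← mul_div_assoc]
  congr 1
  field_simp
  ring

/-! ### The weight of a tableau -/

section Weight

variable (α β)

open scoped Classical in
/-- The contribution of an ordered pair of boxes to the weight. -/
noncomputable def pairWeight (A B : l.Box) : K :=
  if α * boxContent α β A = boxContent α β B then 1 else α * boxContent α β A - boxContent α β B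

/-- The default value `1` only keeps the weights invertible: boxes whose entries get exchanged are
incomparable, and for them the difference itself is nonzero. -/
theorem pairWeight_ne_zero (A B : l.Box) : pairWeight α β A B ≠ 0 := by
  unfold pairWeight
  split_ifs with h
  · exact one_ne_zero
  · exact sub_ne_zero.2 h

/-- The product of the pair weights over the pairs of boxes in increasing order of entries. -/
noncomputable def tableauWeight (f : l.Filling) : K :=
  ∏ q : l.Box × l.Box, if f q.1 < f q.2 then pairWeight α β q.1 q.2 else 1

theorem tableauWeight_ne_zero (f : l.Filling) : tableauWeight α β f ≠ 0 := by
  refine Finset.prod_ne_zero_iff.2 fun q _ => ?_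
  split_ifs
  · exact pairWeight_ne_zero α β _ _
  · exact one_ne_zero

variable {α β}

/-- Exchanging consecutive entries reverses the order of exactly one pair of boxes, so a single
factor of the product changes. -/
theorem tableauWeight_exchange (f : l.Filling) {i j : Fin n} (hij : j.1 = i.1 + 1) :
    tableauWeight α β f * pairWeight α β (f.symm j) (f.symm i) =
      tableauWeight α β (f.exchange i j) * pairWeight α β (f.symm i) (f.symm j) := by
  classical
  set A := f.symm i with hA
  set B := f.symm j with hB
  have fA : f A = i := f.apply_symm_apply i
  have fB : f B = j := f.apply_symm_apply j
  have hAB : A ≠ B := fun h => by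
    rw [h, fB] at fA
    rw [fA] at hij
    omega
  have hne : (A, B) ≠ (B, A) := fun h => hAB (congrArg Prod.fst h)
  have split : ∀ g : l.Filling, tableauWeight α β g =
      (if g A < g B then pairWeight α β A B else 1) *
      ((if g B < g A then pairWeight α β B A else 1) *
      ∏ q ∈ (Finset.univ.erase (A, B)).erase (B, A),
        if g q.1 < g q.2 then pairWeight α β q.1 q.2 else 1) := by
    intro g
    rw [tableauWeight, ← Finset.mul_prod_erase Finset.univ _ (Finset.mem_univ (A, B)),
      ← Finset.mul_prod_erase (Finset.univ.erase (A, B)) _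
        (Finset.mem_erase.2 ⟨hne.symm, Finset.mem_univ (B, A)⟩)]
  have rest : ∏ q ∈ (Finset.univ.erase (A, B)).erase (B, A),
        (if f q.1 < f q.2 then pairWeight α β q.1 q.2 else 1) =
      ∏ q ∈ (Finset.univ.erase (A, B)).erase (B, A),
        if f.exchange i j q.1 < f.exchange i j q.2 then pairWeight α β q.1 q.2 else 1 := by
    refine Finset.prod_congr rfl ?_
    rintro ⟨C, D⟩ hq
    simp only [Finset.mem_erase, Finset.mem_univ, and_true, ne_eq, Prod.mk.injEq] at hq
    have h1 : ¬ (f C = i ∧ f D = j) := fun h => hq.2 ⟨by rw [hA, ← h.1, f.symm_apply_apply],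
      by rw [hB, ← h.2, f.symm_apply_apply]⟩
    have h2 : ¬ (f C = j ∧ f D = i) := fun h => hq.1 ⟨by rw [hB, ← h.1, f.symm_apply_apply],
      by rw [hA, ← h.2, f.symm_apply_apply]⟩
    have : f C < f D ↔ f.exchange i j C < f.exchange i j D := by
      simp only [exchange_apply, Equiv.swap_apply_def]
      generalize f C = u at *
      generalize f D = v at *
      split_ifs <;> simp only [Fin.lt_def, Fin.ext_iff] at * <;> omega
    simp only [this]
  have l1 : i < j := by rw [Fin.lt_def]; omega
  rw [split f, split (f.exchange i j), rest, exchange_apply, exchange_apply, fA, fB,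
    Equiv.swap_apply_left, Equiv.swap_apply_right, if_pos l1, if_neg l1.not_gt, if_pos l1,
    if_neg l1.not_gt]
  ring

/-- With `x`, `y` the contents at `i`, `j`, the weight is multiplied by `(α y - x) / (α x - y)`.
This is minus the quotient of the two off-diagonal coefficients, whose denominators are opposite. -/
theorem tableauWeight_mul (hα : n < orderOf α) (hβ0 : β ≠ 0)
    (hβ : ∀ i : ℤ, |i| ≤ (n : ℤ) - 1 → β ≠ -α ^ i) {f g : l.Filling} (hf : StrictMono f)
    (hg : StrictMono g) {i j : Fin n} (hij : j.1 = i.1 + 1) (h : g = f.exchange i j) :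
    (1 + hoefsmitCoeff α β f i j) * tableauWeight α β f =
      -((1 + hoefsmitCoeff α β g i j) * tableauWeight α β g) := by
  have hinc := (strictMono_exchange_iff hf hij).1 (h ▸ hg)
  have hinc' := not_lt_of_le hf (i := i) (j := j) (by rw [Fin.le_def]; omega)
  have n1 := mul_ct_ne hα hβ0 hβ hinc hinc'
  have n2 := mul_ct_ne hα hβ0 hβ hinc' hinc
  have hne := ct_ne hα (ne_zero_of hα) hβ0 hβ hf (i := i) (j := j) (by omega) (by omega)
  have hw := tableauWeight_exchange (α := α) (β := β) f hij
  rw [pairWeight, pairWeight, if_neg n1, if_neg n2, ← h] at hw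
  rw [one_add_hoefsmitCoeff hα hβ0 hβ hf hij, one_add_hoefsmitCoeff hα hβ0 hβ hg hij, h,
    exchange_symm, exchange_symm, Equiv.swap_apply_left, Equiv.swap_apply_right, ← h]
  generalize boxContent α β (f.symm i) = x at *
  generalize boxContent α β (f.symm j) = y at *
  have h1 : y - x ≠ 0 := sub_ne_zero.2 hne.symm
  have h2 : x - y = -(y - x) := by ring
  rw [h2]
  field_simp
  linear_combination hw

end Weight

/-! ### Isomorphisms on the derived subgroup -/

section Isomorphisms

variable (hα : n < orderOf α) (hβ0 : β ≠ 0) (hβ : ∀ i : ℤ, |i| ≤ (n : ℤ) - 1 → β ≠ -α ^ i)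

theorem exists_pred {k : Fin n} (hk : k.1 ≠ 0) : ∃ i : Fin n, k.1 = i.1 + 1 :=
  ⟨⟨k.1 - 1, by omega⟩, by simp; omega⟩

theorem twist_gen (ε : K ≃+* K) (m : DoublePartition n) (k : Fin n) :
    (MatrixRep.twist ε (hoefsmitRep hα hβ0 hβ m) (artinGen k) :
      Matrix m.StdTableau m.StdTableau K) = hoefsmitGen (ε α) (ε β) m k := by
  change ((hoefsmitRep hα hβ0 hβ m (artinGen k) : Matrix m.StdTableau m.StdTableau K)).map
    (ε : K →+* K) = _
  rw [hoefsmitRep_gen, map_hoefsmitGen]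
  rfl

/-- An automorphism that fixes `α` and rescales the contents. -/
theorem iso_twist_of_fixed {γ : K} (hγ : γ ≠ 0) (ε : K ≃+* K) (hε : ε α = α) (φ : l.Box ≃o m.Box)
    (hφ : ∀ b, boxContent (ε α) (ε β) (φ b) = γ * boxContent α β b) :
    MatrixRep.Iso (hoefsmitRepDerived hα hβ0 hβ l)
      (MatrixRep.twist ε (hoefsmitRepDerived hα hβ0 hβ m)) := by
  refine iso_of_monomial (ρ := hoefsmitRep hα hβ0 hβ l)
    (σ := MatrixRep.twist ε (hoefsmitRep hα hβ0 hβ m)) (tableauEquiv φ) (w := fun _ => 1)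
    (fun _ => one_ne_zero) fun k => ?_
  rw [hoefsmitRep_gen, twist_gen]
  by_cases hk : k.1 = 0
  · rw [hoefsmitGen_zero hk, hoefsmitGen_zero hk]
    exact ⟨γ⁻¹, inv_ne_zero hγ, hoefsmitT_transfer φ hφ hγ hk⟩
  · obtain ⟨i, hi⟩ := exists_pred hk
    rw [hoefsmitGen_succ hi, hoefsmitGen_succ hi]
    have hc : ∀ T : l.StdTableau, hoefsmitCoeff (ε α) (ε β) (tableauEquiv φ T).1 i k =
        hoefsmitCoeff α β T.1 i k := fun T => by
      rw [hoefsmitCoeff_transfer hγ φ hφ, hε, hoefsmitCoeff]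
    refine ⟨1, one_ne_zero, hoefsmitS_transfer φ (fun e => by rw [e] at hi; omega)
      (fun T => by rw [hc, one_mul]) (fun T T' _ => by rw [hc]; ring)⟩

/-- An automorphism that inverts `α` and rescales the contents. -/
theorem iso_twist_of_inv {γ : K} (hγ : γ ≠ 0) (ε : K ≃+* K) (hε : ε α = α⁻¹)
    (φ : l.Box ≃o m.Box) (hφ : ∀ b, boxContent (ε α) (ε β) (φ b) = γ * boxContent α β b) :
    MatrixRep.Iso (hoefsmitRepDerived hα hβ0 hβ l)
      (MatrixRep.twist ε (hoefsmitRepDerived hα hβ0 hβ m)) := by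
  have h0 := ne_zero_of hα
  refine iso_of_monomial (ρ := hoefsmitRep hα hβ0 hβ l)
    (σ := MatrixRep.twist ε (hoefsmitRep hα hβ0 hβ m)) (tableauEquiv φ)
    (w := fun T => tableauWeight α β T.1) (fun T => tableauWeight_ne_zero α β T.1) fun k => ?_
  rw [hoefsmitRep_gen, twist_gen]
  by_cases hk : k.1 = 0
  · rw [hoefsmitGen_zero hk, hoefsmitGen_zero hk]
    exact ⟨γ⁻¹, inv_ne_zero hγ, hoefsmitT_transfer φ hφ hγ hk⟩
  · obtain ⟨i, hi⟩ := exists_pred hk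
    rw [hoefsmitGen_succ hi, hoefsmitGen_succ hi]
    have hc : ∀ T : l.StdTableau, hoefsmitCoeff (ε α) (ε β) (tableauEquiv φ T).1 i k =
        -α⁻¹ * hoefsmitCoeff α β T.1 i k := fun T => by
      rw [hoefsmitCoeff_transfer hγ φ hφ, hε, hoefsmitCoeff_inv _ h0]
    -- The roots of the quadratic relation are `α`, `-1` on one side and `α⁻¹`, `-1` on the other;
    -- multiplication by `-α` interchanges the two lists.
    refine ⟨-α, neg_ne_zero.2 h0, hoefsmitS_transfer φ (fun e => by rw [e] at hi; omega)
      (fun T => by rw [hc]; field_simp) (fun T T' h => ?_)⟩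
    have hw := tableauWeight_mul hα hβ0 hβ T.2 T'.2 hi h
    have hcoeff : hoefsmitCoeff α β T'.1 i k = α - 1 - hoefsmitCoeff α β T.1 i k := by
      rw [h, hoefsmitCoeff_exchange, coeff_swap hα hβ0 hβ T.2 hi]
    rw [hw, hc, hcoeff]
    field_simp
    ring

theorem dual_gen_mul (m : DoublePartition n) (k : Fin n) :
    (MatrixRep.dual (hoefsmitRep hα hβ0 hβ m) (artinGen k) :
      Matrix m.StdTableau m.StdTableau K) * (hoefsmitGen α β m k)ᵀ = 1 := by
  have h := (MatrixRep.dual (hoefsmitRep hα hβ0 hβ m) (artinGen k)).mul_inv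
  rw [← hoefsmitRep_gen hα hβ0 hβ]
  exact h

/-- The dual of a generator, as a function of its transpose. -/
theorem dual_gen_succ (m : DoublePartition n) {i k : Fin n} (hi : k.1 = i.1 + 1) :
    (MatrixRep.dual (hoefsmitRep hα hβ0 hβ m) (artinGen k) :
      Matrix m.StdTableau m.StdTableau K) =
      α⁻¹ • ((hoefsmitS α β m i k)ᵀ - (α - 1) • 1) := by
  have h := dual_gen_mul hα hβ0 hβ m k
  rw [hoefsmitGen_succ hi] at h
  have h0 := ne_zero_of hα
  have hq := congrArg Matrix.transpose (quadratic (l := m) hα hβ0 hβ hi)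
  rw [Matrix.transpose_mul, Matrix.transpose_add, Matrix.transpose_smul, Matrix.transpose_smul,
    Matrix.transpose_one] at hq
  refine (left_inv_eq_right_inv h ?_)
  rw [Matrix.mul_smul, Matrix.mul_sub, hq, Matrix.mul_smul, mul_one, add_sub_cancel_left, smul_smul,
    inv_mul_cancel₀ h0, one_smul]

theorem dual_gen_zero (m : DoublePartition n) {k : Fin n} (hk : k.1 = 0) :
    (MatrixRep.dual (hoefsmitRep hα hβ0 hβ m) (artinGen k) :
      Matrix m.StdTableau m.StdTableau K) =
      Matrix.diagonal fun U => (boxContent α β (U.1.symm k))⁻¹ := by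
  have h := dual_gen_mul hα hβ0 hβ m k
  rw [hoefsmitGen_zero hk] at h
  refine (left_inv_eq_right_inv h ?_)
  rw [hoefsmitT, Matrix.diagonal_transpose, Matrix.diagonal_mul_diagonal, ← Matrix.diagonal_one]
  congr 1
  funext U
  rw [← boxContent_first (α := α) U.2 hk, mul_inv_cancel₀ (ct_ne_zero (ne_zero_of hα) hβ0 _)]

/-- The dual of `R_m` is the representation of the transposed shape on the derived subgroup. -/
theorem iso_transpose_dual (m : DoublePartition n) :
    MatrixRep.Iso (hoefsmitRepDerived hα hβ0 hβ m.transpose)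
      (MatrixRep.dual (hoefsmitRepDerived hα hβ0 hβ m)) := by
  have h0 := ne_zero_of hα
  obtain ⟨T₀⟩ := nonempty_stdTableau m.transpose
  let φ := transposeBoxIso m
  have hφ : ∀ b, boxContent α β (φ b) = -β * (boxContent α β b)⁻¹ := content_transposeBoxIso hβ0
  -- The sign of `T` relative to a fixed tableau: all that matters is that each exchange reverses
  -- it.
  let w : m.transpose.StdTableau → K := fun T =>
    ((Equiv.Perm.sign (T₀.1.symm.trans T.1) : ℤˣ) : ℤ)
  have hw : ∀ T, w T ≠ 0 := fun T => by
    rcases Int.units_eq_one_or (Equiv.Perm.sign (T₀.1.symm.trans T.1)) with h | h <;> simp [w, h]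
  have hwx : ∀ {i j : Fin n}, i ≠ j → ∀ T T' : m.transpose.StdTableau,
      T'.1 = T.1.exchange i j → w T' = -w T := by
    intro i j hij T T' h
    have : T₀.1.symm.trans T'.1 = Equiv.swap i j * T₀.1.symm.trans T.1 := by
      rw [h]; rfl
    simp only [w]
    rw [this, Equiv.Perm.sign_mul, Equiv.Perm.sign_swap hij]
    simp
  refine iso_of_monomial (ρ := hoefsmitRep hα hβ0 hβ m.transpose)
    (σ := MatrixRep.dual (hoefsmitRep hα hβ0 hβ m)) (tableauEquiv φ) hw fun k => ?_
  rw [hoefsmitRep_gen]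
  by_cases hk : k.1 = 0
  · rw [hoefsmitGen_zero hk, dual_gen_zero hα hβ0 hβ m hk]
    refine ⟨-β, neg_ne_zero.2 hβ0, fun T₁ T₂ => ?_⟩
    by_cases h : T₁ = T₂
    · subst h
      have hct := ct_ne_zero (l := m.transpose) h0 hβ0 (T₁.1.symm k)
      rw [hoefsmitT, Matrix.diagonal_apply_eq, Matrix.diagonal_apply_eq, tableauEquiv_symm_apply,
        hφ, ← boxContent_first (α := α) T₁.2 hk]
      field_simp
    · rw [hoefsmitT, Matrix.diagonal_apply_ne _ h,
        Matrix.diagonal_apply_ne _ (fun h' => h (Equiv.injective _ h'))]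
      ring
  · obtain ⟨i, hi⟩ := exists_pred hk
    have hik : i ≠ k := fun e => by rw [e] at hi; omega
    rw [hoefsmitGen_succ hi, dual_gen_succ hα hβ0 hβ m hi]
    -- Inverting the contents inverts their ratio, that is, interchanges the roles of `i` and `k`.
    have hc : ∀ T : m.transpose.StdTableau, hoefsmitCoeff α β (tableauEquiv φ T).1 i k =
        α - 1 - hoefsmitCoeff α β T.1 i k := fun T => by
      rw [← coeff_swap hα hβ0 hβ T.2 hi, hoefsmitCoeff, hoefsmitCoeff, tableauEquiv_symm_apply,
        tableauEquiv_symm_apply, hφ, hφ, mul_div_mul_left _ _ (neg_ne_zero.2 hβ0), inv_div_inv]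
    refine ⟨-α, neg_ne_zero.2 h0, fun T₁ T₂ => ?_⟩
    rw [Matrix.smul_apply, Matrix.sub_apply, Matrix.smul_apply, Matrix.transpose_apply,
      smul_eq_mul, smul_eq_mul]
    by_cases h : T₁ = T₂
    · subst h
      rw [hoefsmitS_apply_self _ hik, hoefsmitS_apply_self _ hik, hc, Matrix.one_apply_eq]
      field_simp
      ring
    · have h' : tableauEquiv φ T₁ ≠ tableauEquiv φ T₂ := fun h' => h (Equiv.injective _ h')
      rw [Matrix.one_apply_ne h']
      -- The transpose evaluates the coefficient at `T₁`, and the relabelling turns it back into the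
      -- coefficient at `T₂`; the remaining sign is absorbed by `w`.
      by_cases hx : T₁.1 = T₂.1.exchange i k
      · have hx' : T₂.1 = T₁.1.exchange i k := by rw [hx, exchange_exchange]
        rw [hoefsmitS_apply_exchange hik hx,
          hoefsmitS_apply_exchange hik ((tableauEquiv_exchange_iff φ _ _ _ _).2 hx'), hc,
          hwx hik _ _ hx, hx, hoefsmitCoeff_exchange, coeff_swap hα hβ0 hβ T₂.2 hi]
        field_simp
        ring
      · rw [hoefsmitS_apply_of_ne h hx, hoefsmitS_apply_of_ne h'.symm]
        · ring
        · intro hx'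
          rw [tableauEquiv_exchange_iff] at hx'
          exact hx (by rw [hx', exchange_exchange])

end Isomorphisms

end HoefsmitAux

/-! ### Composition of the operations on shapes -/

namespace DoublePartition

variable {n : ℕ}

theorem transpose_transpose (m : DoublePartition n) : m.transpose.transpose = m :=
  DoublePartition.ext (YoungDiagram.transpose_transpose _) (YoungDiagram.transpose_transpose _)

theorem transposeEach_transpose (m : DoublePartition n) : m.transpose.transposeEach = m.swap :=
  DoublePartition.ext (YoungDiagram.transpose_transpose _) (YoungDiagram.transpose_transpose _)

theorem swap_transpose (m : DoublePartition n) : m.transpose.swap = m.transposeEach := rfl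

end DoublePartition

/-! ### Reduction of duals and twists to equality of shapes -/

section Classification

open HoefsmitAux

variable {n : ℕ} {K : Type*} [Field K] {α β : K} {hα : n < orderOf α} {hβ0 : β ≠ 0}
  {hβ : ∀ i : ℤ, |i| ≤ (n : ℤ) - 1 → β ≠ -α ^ i} {l m : DoublePartition n}

theorem hoefsmitRepDerived_iso_iff (hβ1 : β ≠ 1) (hl : l.NoEmptyComponent) :
    MatrixRep.Iso (hoefsmitRepDerived hα hβ0 hβ l) (hoefsmitRepDerived hα hβ0 hβ m) ↔ l = m :=
  ⟨eq_of_iso_derived hβ1 hl, fun h => h ▸ MatrixRep.Iso.refl _⟩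

theorem hoefsmitRepDerived_iso_dual_iff (hβ1 : β ≠ 1) (hl : l.NoEmptyComponent) :
    MatrixRep.Iso (hoefsmitRepDerived hα hβ0 hβ l)
      (MatrixRep.dual (hoefsmitRepDerived hα hβ0 hβ m)) ↔ l = m.transpose :=
  (MatrixRep.Iso.congr_right (iso_transpose_dual hα hβ0 hβ m)).symm.trans
    (hoefsmitRepDerived_iso_iff hβ1 hl)

/-- If twisting by `ε` corresponds to the operation `τ` on shapes, then the isomorphisms with
twisted representations and with their duals are determined by `τ`. -/
theorem hoefsmitRepDerived_iso_twist_iff (hβ1 : β ≠ 1) (hl : l.NoEmptyComponent) (ε : K ≃+* K)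
    (τ : DoublePartition n → DoublePartition n)
    (hτ : ∀ m, MatrixRep.Iso (hoefsmitRepDerived hα hβ0 hβ (τ m))
      (MatrixRep.twist ε (hoefsmitRepDerived hα hβ0 hβ m))) :
    (MatrixRep.Iso (hoefsmitRepDerived hα hβ0 hβ l)
      (MatrixRep.twist ε (hoefsmitRepDerived hα hβ0 hβ m)) ↔ l = τ m) ∧
    (MatrixRep.Iso (hoefsmitRepDerived hα hβ0 hβ l)
      (MatrixRep.twist ε (MatrixRep.dual (hoefsmitRepDerived hα hβ0 hβ m))) ↔
        l = τ m.transpose) :=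
  ⟨(MatrixRep.Iso.congr_right (hτ m)).symm.trans (hoefsmitRepDerived_iso_iff hβ1 hl),
    (MatrixRep.Iso.congr_right
      -- The twisted dual of `R_m` is the twist of the representation of the transposed shape, to
      -- which `hτ` applies.
      ((hτ m.transpose).trans ((iso_transpose_dual hα hβ0 hβ m).twist ε))).symm.trans
        (hoefsmitRepDerived_iso_iff hβ1 hl)⟩

end Classification

/-! ### The four field configurations -/

theorem mainTheorem9 (p : ℕ) [Fact p.Prime] (n : ℕ) {K : Type*} [Field K] [Finite K]
    [Algebra (ZMod p) K] (α β : K)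
    -- `K = 𝔽_p(α, β)`
    (hK : IntermediateField.adjoin (ZMod p) {α, β} = ⊤)
    (hα : n < orderOf α) (hα' : orderOf α ∉ ({1, 2, 3, 4, 5, 6, 8, 10} : Set ℕ))
    (hβ0 : β ≠ 0) (hβ1 : β ≠ 1) (hβ : ∀ i : ℤ, |i| ≤ (n : ℤ) - 1 → β ≠ -α ^ i)
    (l m : DoublePartition n) (hl : l.NoEmptyComponent) (hm : m.NoEmptyComponent) :
    -- first configuration
    (IntermediateField.adjoin (ZMod p) {α + α⁻¹, β + β⁻¹} = ⊤ →
      (MatrixRep.Iso (hoefsmitRepDerived hα hβ0 hβ l) (hoefsmitRepDerived hα hβ0 hβ m) ↔ l = m) ∧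
      (MatrixRep.Iso (hoefsmitRepDerived hα hβ0 hβ l)
          (MatrixRep.dual (hoefsmitRepDerived hα hβ0 hβ m)) ↔ l = m.transpose)) ∧
    -- second configuration
    (IntermediateField.adjoin (ZMod p) {α + α⁻¹, β} = ⊤ →
      IntermediateField.adjoin (ZMod p) {α, β + β⁻¹} = ⊤ →
      IntermediateField.adjoin (ZMod p) {α + α⁻¹, β + β⁻¹} ≠ ⊤ →
      (MatrixRep.Iso (hoefsmitRepDerived hα hβ0 hβ l) (hoefsmitRepDerived hα hβ0 hβ m) ↔ l = m) ∧
      (MatrixRep.Iso (hoefsmitRepDerived hα hβ0 hβ l)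
          (MatrixRep.dual (hoefsmitRepDerived hα hβ0 hβ m)) ↔ l = m.transpose) ∧
      ∃ ε : K ≃+* K, (∀ σ : K ≃+* K, orderOf σ = 2 ↔ σ = ε) ∧
        (MatrixRep.Iso (hoefsmitRepDerived hα hβ0 hβ l)
            (MatrixRep.twist ε (hoefsmitRepDerived hα hβ0 hβ m)) ↔ l = m.transpose) ∧
        (MatrixRep.Iso (hoefsmitRepDerived hα hβ0 hβ l)
            (MatrixRep.twist ε (MatrixRep.dual (hoefsmitRepDerived hα hβ0 hβ m))) ↔ l = m)) ∧
    -- third configuration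
    (IntermediateField.adjoin (ZMod p) {α, β + β⁻¹} = ⊤ →
      IntermediateField.adjoin (ZMod p) {α + α⁻¹, β} ≠ ⊤ →
      IntermediateField.adjoin (ZMod p) {α + α⁻¹, β} = IntermediateField.adjoin (ZMod p) {α + α⁻¹, β + β⁻¹} →
      (MatrixRep.Iso (hoefsmitRepDerived hα hβ0 hβ l) (hoefsmitRepDerived hα hβ0 hβ m) ↔ l = m) ∧
      (MatrixRep.Iso (hoefsmitRepDerived hα hβ0 hβ l)
          (MatrixRep.dual (hoefsmitRepDerived hα hβ0 hβ m)) ↔ l = m.transpose) ∧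
      ∃ ε : K ≃+* K, (∀ σ : K ≃+* K, orderOf σ = 2 ↔ σ = ε) ∧
        (MatrixRep.Iso (hoefsmitRepDerived hα hβ0 hβ l)
            (MatrixRep.twist ε (hoefsmitRepDerived hα hβ0 hβ m)) ↔ l = m.transposeEach) ∧
        (MatrixRep.Iso (hoefsmitRepDerived hα hβ0 hβ l)
            (MatrixRep.twist ε (MatrixRep.dual (hoefsmitRepDerived hα hβ0 hβ m))) ↔ l = m.swap)) ∧
    -- fourth configuration
    (IntermediateField.adjoin (ZMod p) {α + α⁻¹, β} = ⊤ →
      IntermediateField.adjoin (ZMod p) {α, β + β⁻¹} ≠ ⊤ →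
      IntermediateField.adjoin (ZMod p) {α, β + β⁻¹} = IntermediateField.adjoin (ZMod p) {α + α⁻¹, β + β⁻¹} →
      (MatrixRep.Iso (hoefsmitRepDerived hα hβ0 hβ l) (hoefsmitRepDerived hα hβ0 hβ m) ↔ l = m) ∧
      (MatrixRep.Iso (hoefsmitRepDerived hα hβ0 hβ l)
          (MatrixRep.dual (hoefsmitRepDerived hα hβ0 hβ m)) ↔ l = m.transpose) ∧
      ∃ ε : K ≃+* K, (∀ σ : K ≃+* K, orderOf σ = 2 ↔ σ = ε) ∧
        (MatrixRep.Iso (hoefsmitRepDerived hα hβ0 hβ l)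
            (MatrixRep.twist ε (hoefsmitRepDerived hα hβ0 hβ m)) ↔ l = m.swap) ∧
        (MatrixRep.Iso (hoefsmitRepDerived hα hβ0 hβ l)
            (MatrixRep.twist ε (MatrixRep.dual (hoefsmitRepDerived hα hβ0 hβ m))) ↔ l = m.transposeEach)) := by
  have h0 := HoefsmitAux.ne_zero_of hα
  have ha := hoefsmitRepDerived_iso_iff (hα := hα) (hβ0 := hβ0) (hβ := hβ) (m := m) hβ1 hl
  have hb := hoefsmitRepDerived_iso_dual_iff (hα := hα) (hβ0 := hβ0) (hβ := hβ) (m := m) hβ1 hl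
  refine ⟨fun _ => ⟨ha, hb⟩, fun h1 h2 h3 => ⟨ha, hb, ?_⟩, fun h1 h2 h3 => ⟨ha, hb, ?_⟩,
    fun h1 h2 h3 => ⟨ha, hb, ?_⟩⟩
  · obtain ⟨ε, hε1, hfix, hεα, hεβ⟩ := exists_algEquiv_ne_one (p := p) h0 hβ0 h3
    have hmem : ∀ x ∈ ({α + α⁻¹, β + β⁻¹} : Set K), ε x = x := fun x hx =>
      hfix x (IntermediateField.subset_adjoin _ _ hx)
    -- Fixing `α` as well as `β + β⁻¹` would make `ε` trivial by `h2`; symmetrically for `β` by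
    -- `h1`.
    have eα : ε α = α⁻¹ := hεα.resolve_left fun h => hε1 <|
      algEquiv_eq_one_of_adjoin_eq_top h2 (by
        rintro x (rfl | rfl)
        · exact h
        · exact hmem _ (by simp))
    have eβ : ε β = β⁻¹ := hεβ.resolve_left fun h => hε1 <|
      algEquiv_eq_one_of_adjoin_eq_top h1 (by
        rintro x (rfl | rfl)
        · exact hmem _ (by simp)
        · exact h)
    refine ⟨ε, orderOf_eq_two_iff_eq hK hε1 hεα hεβ, ?_⟩
    have := hoefsmitRepDerived_iso_twist_iff (hα := hα) (hβ0 := hβ0) (hβ := hβ) (m := m) hβ1 hl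
      (ε : K ≃+* K) DoublePartition.transpose fun m =>
        HoefsmitAux.iso_twist_of_inv hα hβ0 hβ (neg_ne_zero.2 (inv_ne_zero hβ0)) _ eα
          (HoefsmitAux.transposeBoxIso m) fun b => by
            rw [AlgEquiv.coe_ringEquiv, eα, eβ]
            exact HoefsmitAux.content_inv_transposeBoxIso hβ0 b
    rwa [DoublePartition.transpose_transpose] at this
  · obtain ⟨ε, hε1, hfix, hεα, hεβ⟩ := exists_algEquiv_ne_one (p := p) h0 hβ0 (h3 ▸ h2)
    -- By `h3` the fixed subfield already contains `β`, so a nontrivial `ε` has to invert `α`.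
    have eβ : ε β = β := hfix β (h3 ▸ IntermediateField.subset_adjoin _ _ (by simp))
    have eα : ε α = α⁻¹ := hεα.resolve_left fun h => hε1 <|
      algEquiv_eq_one_of_adjoin_eq_top hK (by
        rintro x (rfl | rfl)
        · exact h
        · exact eβ)
    refine ⟨ε, orderOf_eq_two_iff_eq hK hε1 hεα hεβ, ?_⟩
    have := hoefsmitRepDerived_iso_twist_iff (hα := hα) (hβ0 := hβ0) (hβ := hβ) (m := m) hβ1 hl
      (ε : K ≃+* K) DoublePartition.transposeEach fun m =>
        HoefsmitAux.iso_twist_of_inv hα hβ0 hβ one_ne_zero _ eα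
          (HoefsmitAux.transposeEachBoxIso m) fun b => by
            rw [AlgEquiv.coe_ringEquiv, eα, eβ, one_mul]
            exact HoefsmitAux.content_transposeEachBoxIso b
    rwa [DoublePartition.transposeEach_transpose] at this
  · obtain ⟨ε, hε1, hfix, hεα, hεβ⟩ := exists_algEquiv_ne_one (p := p) h0 hβ0 (h3 ▸ h2)
    -- Here the fixed subfield contains `α`, so `ε` has to invert `β`, and constant weights suffice.
    have eα : ε α = α := hfix α (h3 ▸ IntermediateField.subset_adjoin _ _ (by simp))
    have eβ : ε β = β⁻¹ := hεβ.resolve_left fun h => hε1 <|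
      algEquiv_eq_one_of_adjoin_eq_top hK (by
        rintro x (rfl | rfl)
        · exact eα
        · exact h)
    refine ⟨ε, orderOf_eq_two_iff_eq hK hε1 hεα hεβ, ?_⟩
    have := hoefsmitRepDerived_iso_twist_iff (hα := hα) (hβ0 := hβ0) (hβ := hβ) (m := m) hβ1 hl
      (ε : K ≃+* K) DoublePartition.swap fun m =>
        HoefsmitAux.iso_twist_of_fixed hα hβ0 hβ (neg_ne_zero.2 (inv_ne_zero hβ0)) _ eα
          (HoefsmitAux.swapBoxIso m) fun b => by
            rw [AlgEquiv.coe_ringEquiv, eα, eβ]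
            exact HoefsmitAux.content_swapBoxIso hβ0 b
    rwa [DoublePartition.swap_transpose] at this
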